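/- Let $n\ge 1$. Consider $n$ point particles on the line with masses $m_1,\dots,m_n>0$, with positions $q_1(t)\le\dots\le q_n(t)$ for all $t\in\mathbb R$. They interact only through elastic collisions of two particles: between collisions each particle moves with constant velocity, and in a collision of two particles their momentum and their kinetic energy are conserved while their order on the line is kept. Initial data are positions $q_1(0)<\dots<q_n(0)$ and velocities $v_1(0),\dots,v_n(0)\in\mathbb R$ at time $0$. The number of collisions is counted over the whole time axis $t\in\mathbb R$. For every $\varepsilon>0$ there exist non-empty open sets $V_i=W_i\times U_i\subset(1-\varepsilon,1+\varepsilon)^n\times(\mathbb R^n\times\mathbb R^n)$, $i=1,2,3$, consisting of positive masses and of initial data as above, such that for all masses and initial data in $V_i$ there is exactly one such motion (in particular, no three particles ever meet at one point), and its number of collisions is exactly 1. $n-1$ on $V_1$, 2. $\binom n2$ on $V_2$, 3. $\binom{n+1}3$ on $V_3$. Consequently, for every neighbourhood $O$ of the diagonal $\{(c,\dots,c): c>0\}$ in the space of masses, each of these three collision numbers occurs on a non-empty open set $W\times U$ of masses and initial data with $W\subset O$. -/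

import Mathlib

open Set Filter Topology

/-- `IsElasticMotion m γ`: the curve `t ↦ γ t`, defined for all times `t ∈ ℝ`, is a motion on the
line of `n` point particles with masses `m`, which interact only through elastic collisions of two
particles (disjoint pairs may collide at the same time). -/
structure IsElasticMotion {n : ℕ} (m : Fin n → ℝ) (γ : ℝ → Fin n → ℝ) : Prop where
  /-- The particles never change their order. -/
  ordered : ∀ t, Monotone (γ t)
  /-- Three particles are never at the same place: all collisions are binary. -/
  binary : ∀ t i j k, i < j → j < k → ¬ (γ t i = γ t j ∧ γ t j = γ t k)
  /-- Just before and just after any time `t` the particles move uniformly, with velocities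
  `u` and `w`. A particle which does not collide at time `t` keeps its velocity, and a pair which
  collides at time `t` keeps its momentum and its kinetic energy. -/
  elastic : ∀ t, ∃ u w : Fin n → ℝ,
    (∀ i, ∀ᶠ s in 𝓝[<] t, γ s i = γ t i + (s - t) * u i) ∧
    (∀ i, ∀ᶠ s in 𝓝[>] t, γ s i = γ t i + (s - t) * w i) ∧
    (∀ i, (∀ j, j ≠ i → γ t j ≠ γ t i) → w i = u i) ∧
    (∀ i j, i < j → γ t i = γ t j →
      m i * w i + m j * w j = m i * u i + m j * u j ∧
      m i * w i ^ 2 / 2 + m j * w j ^ 2 / 2 = m i * u i ^ 2 / 2 + m j * u j ^ 2 / 2)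

/-- The motion `γ` has at time `0` the positions `x.1` and the velocities `x.2`. -/
def HasInitialData {n : ℕ} (x : (Fin n → ℝ) × (Fin n → ℝ)) (γ : ℝ → Fin n → ℝ) : Prop :=
  γ 0 = x.1 ∧ ∀ i, HasDerivAt (fun t => γ t i) (x.2 i) 0

/-- The collisions of a motion, over the whole time axis: the times `t` together with the
pairs `i < j` of particles which meet at time `t`. -/
def collisions {n : ℕ} (γ : ℝ → Fin n → ℝ) : Set (ℝ × Fin n × Fin n) :=
  {c | c.2.1 < c.2.2 ∧ γ c.1 c.2.1 = γ c.1 c.2.2}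

/-- For masses `m` and initial data `x` there is exactly one motion, and it has exactly `N`
collisions. -/
def HasCollisionNumber {n : ℕ} (m : Fin n → ℝ) (x : (Fin n → ℝ) × (Fin n → ℝ)) (N : ℕ) : Prop :=
  ∃ γ : ℝ → Fin n → ℝ, IsElasticMotion m γ ∧ HasInitialData x γ ∧
    (∀ γ' : ℝ → Fin n → ℝ, IsElasticMotion m γ' → HasInitialData x γ' → γ' = γ) ∧
    (collisions γ).encard = N

/-- The space of masses `(0,∞)^n`. -/
def massSpace (n : ℕ) : Set (Fin n → ℝ) := {m | ∀ k, 0 < m k}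

/-- The phase space: initial positions are strictly ordered, initial velocities are arbitrary. -/
def phaseSpace (n : ℕ) : Set ((Fin n → ℝ) × (Fin n → ℝ)) := {x | StrictMono x.1}

/-- The diagonal of the space of masses. -/
def massDiagonal (n : ℕ) : Set (Fin n → ℝ) := {m | ∃ c : ℝ, 0 < c ∧ ∀ k, m k = c}

/-- There are non-empty open sets `W` of masses in `B` and `U` of initial data, such
that the number of collisions is exactly `N` for all masses and initial data in `W × U`. -/
def ExistsOpenWithCollisions {n : ℕ} (B : Set (Fin n → ℝ)) (N : ℕ) : Prop :=
  ∃ (W : Set (Fin n → ℝ)) (U : Set ((Fin n → ℝ) × (Fin n → ℝ))),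
    IsOpen W ∧ W.Nonempty ∧ W ⊆ B ∩ massSpace n ∧
    IsOpen U ∧ U.Nonempty ∧ U ⊆ phaseSpace n ∧
    ∀ m ∈ W, ∀ x ∈ U, HasCollisionNumber m x N

/-! In the metric weighted by the masses, a collision of neighbours is the orthogonal reflection
`bounce` in the hyperplane where their positions agree. A motion is therefore a straight line folded
by successive reflections. `Past` records a history as a finite chain of time steps, each containing
one collision. It is made of strict inequalities between quantities continuous in masses, positions
and velocities, so it persists under small perturbations (`Past.eventually`). If the final
velocities increase, the chain accounts for all collisions, and the open sets come for free. It
remains to exhibit one such history for each number.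

`Sorts` removes positions from the problem: if every possible order of collisions sorts the
velocities in the same number of steps, then a generic choice of positions, made inside an open set,
realises that number (`exists_past_of_sorts`).

For $\binom n2$, equal masses exchange velocities, and each collision removes exactly one inversion.
For $n-1$, a fast particle passes its momentum down the line; each target is slightly heavier than
its striker, which ends just slower than the target was before, and no pair meets again.

For $\binom{n+1}3$, the masses are $1+\delta k^2$. Particles are added one at a time from the far
right, each with an enormous velocity $-a$. When the momentum passes from particle $l+1$ to particle
$l$, particle $l+1$ keeps a fraction of the velocity proportional to the mass difference
$\delta(2l+1)$. In units of $\delta a$ it is left with nearly $-(2l+1)/2$, which decreases with $l$.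
So the fast crossing costs $n$ collisions and leaves $n$ particles in reversed order. Being nearly
of equal mass, these need $\binom n2$ more, together $\binom{n+1}2$; Pascal's rule sums these
contributions. `Crossing` expresses this in strict inequalities that still make sense at $\delta=0$,
where `crossing_zero` checks them. -/

/-! ### Uniqueness of elastic motions. -/

theorem elastic_pair {a b u₁ u₂ w₁ w₂ : ℝ} (ha : 0 < a)
    (hmom : a * w₁ + b * w₂ = a * u₁ + b * u₂)
    (hen : a * w₁ ^ 2 / 2 + b * w₂ ^ 2 / 2 = a * u₁ ^ 2 / 2 + b * u₂ ^ 2 / 2)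
    (hb : 0 < b) (hu : u₂ ≤ u₁) (hw : w₁ ≤ w₂) :
    w₁ = u₁ - 2 * b / (a + b) * (u₁ - u₂) ∧ w₂ = u₂ + 2 * a / (a + b) * (u₁ - u₂) := by
  have hrel : w₁ - w₂ = u₂ - u₁ := by
    have h1 : b * (w₂ - u₂) = -(a * (w₁ - u₁)) := by linarith
    have h2 : (a * (w₁ - u₁)) * ((w₁ + u₁) - (w₂ + u₂)) = 0 := by
      linear_combination 2 * hen - (w₂ + u₂) * hmom
    -- The conservation laws have two roots. If the velocities are unchanged, approach before and
    -- separation after force them to be equal, so the relative velocity is reversed in this case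
    -- too.
    rcases mul_eq_zero.1 h2 with h | h
    · have h3 : w₁ - u₁ = 0 := by simpa [ha.ne'] using h
      have h4 : w₂ - u₂ = 0 := by
        rw [h, neg_zero] at h1
        simpa [hb.ne'] using h1
      linarith
    · linarith
  have hab : a + b ≠ 0 := by positivity
  constructor
  · field_simp
    linear_combination hmom + b * hrel
  · field_simp
    linear_combination hmom - a * hrel

theorem eq_of_affine_germ {F : Filter ℝ} [F.NeBot] {t a u u' : ℝ} (hF : ∀ᶠ s in F, s ≠ t)
    (h : ∀ᶠ s in F, a + (s - t) * u = a + (s - t) * u') : u = u' := by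
  obtain ⟨s, hs, hs'⟩ := (hF.and h).exists
  have : (s - t) * u = (s - t) * u' := by linarith
  exact mul_left_cancel₀ (sub_ne_zero.2 hs) this

section Uniqueness

variable {n : ℕ} {m : Fin n → ℝ} {γ γ' : ℝ → Fin n → ℝ}

theorem IsElasticMotion.reverse (h : IsElasticMotion m γ) :
    IsElasticMotion m (fun t => γ (-t)) where
  ordered t := h.ordered (-t)
  binary t := h.binary (-t)
  elastic t := by
    obtain ⟨u, w, hu, hw, hf, hc⟩ := h.elastic (-t)
    refine ⟨-w, -u, fun i => ?_, fun i => ?_, fun i hi => ?_, fun i j hij he => ?_⟩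
    · have := (tendsto_neg_nhdsLT (a := t)).eventually (hw i)
      filter_upwards [this] with s hs
      rw [hs, Pi.neg_apply]; ring
    · have := (tendsto_neg_nhdsGT (a := t)).eventually (hu i)
      filter_upwards [this] with s hs
      rw [hs, Pi.neg_apply]; ring
    · simp [hf i hi]
    · obtain ⟨h1, h2⟩ := hc i j hij he
      simp only [Pi.neg_apply, neg_sq]
      exact ⟨by linarith, h2.symm⟩

theorem IsElasticMotion.continuous (h : IsElasticMotion m γ) : Continuous γ := by
  refine continuous_pi fun i => continuous_iff_continuousAt.2 fun t => ?_
  obtain ⟨u, w, hu, hw, -, -⟩ := h.elastic t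
  have key : ∀ c : ℝ, ∀ F : Filter ℝ, F ≤ 𝓝 t → (∀ᶠ s in F, γ s i = γ t i + (s - t) * c) →
      Tendsto (fun s => γ s i) F (𝓝 (γ t i)) := by
    intro c F hF hc
    have : Tendsto (fun s => γ t i + (s - t) * c) (𝓝 t) (𝓝 (γ t i + (t - t) * c)) := by
      apply Continuous.tendsto; fun_prop
    rw [sub_self, zero_mul, add_zero] at this
    exact (this.mono_left hF).congr' (hc.mono fun s hs => hs.symm)
  rw [continuousAt_iff_continuous_left'_right']
  exact ⟨key _ _ nhdsWithin_le_nhds (hu i), key _ _ nhdsWithin_le_nhds (hw i)⟩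

/-- The left germ fixes the incoming velocities. The preserved order makes each meeting pair
approach before and separate after, so `elastic_pair` determines its outgoing velocities. -/
theorem IsElasticMotion.eventually_right (hm : ∀ i, 0 < m i) (h : IsElasticMotion m γ)
    (h' : IsElasticMotion m γ') {t : ℝ} (ht : γ t = γ' t)
    (hl : ∀ᶠ s in 𝓝[<] t, γ s = γ' s) : ∀ᶠ s in 𝓝[>] t, γ s = γ' s := by
  obtain ⟨u, w, hu, hw, hf, hc⟩ := h.elastic t
  obtain ⟨u', w', hu', hw', hf', hc'⟩ := h'.elastic t
  have huu : u = u' := by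
    funext i
    refine eq_of_affine_germ (F := 𝓝[<] t) (t := t) (a := γ t i)
      (eventually_mem_nhdsWithin.mono fun s hs => ne_of_lt hs) ?_
    filter_upwards [hu i, hu' i, hl] with s h1 h2 h3
    rw [← h1, h3, h2, ht]
  subst huu
  have left_le : ∀ {γ : ℝ → Fin n → ℝ} {u : Fin n → ℝ}, IsElasticMotion m γ →
      (∀ i, ∀ᶠ s in 𝓝[<] t, γ s i = γ t i + (s - t) * u i) →
      ∀ i j, i < j → γ t i = γ t j → u j ≤ u i := by
    intro γ u h hu i j hij he
    obtain ⟨s, hs, h1, h2⟩ := ((eventually_mem_nhdsWithin (a := t) (s := Iio t)).and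
      ((hu i).and (hu j))).exists
    have h3 := h.ordered s hij.le
    rw [h1, h2, he] at h3
    have hs : s < t := hs
    nlinarith
  have right_le : ∀ {γ : ℝ → Fin n → ℝ} {u : Fin n → ℝ}, IsElasticMotion m γ →
      (∀ i, ∀ᶠ s in 𝓝[>] t, γ s i = γ t i + (s - t) * u i) →
      ∀ i j, i < j → γ t i = γ t j → u i ≤ u j := by
    intro γ u h hu i j hij he
    obtain ⟨s, hs, h1, h2⟩ := ((eventually_mem_nhdsWithin (a := t) (s := Ioi t)).and
      ((hu i).and (hu j))).exists
    have h3 := h.ordered s hij.le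
    rw [h1, h2, he] at h3
    have hs : t < s := hs
    nlinarith
  have pair : ∀ i j, i < j → γ t i = γ t j → w i = w' i ∧ w j = w' j := by
    intro i j hij he
    have he' : γ' t i = γ' t j := by rw [← ht, he]
    obtain ⟨h1, h2⟩ := hc i j hij he
    obtain ⟨h1', h2'⟩ := hc' i j hij he'
    have hle := left_le h hu i j hij he
    have e := elastic_pair (hm i) h1 h2 (hm j) hle (right_le h hw i j hij he)
    have e' := elastic_pair (hm i) h1' h2' (hm j) hle (right_le h' hw' i j hij he')
    exact ⟨e.1.trans e'.1.symm, e.2.trans e'.2.symm⟩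
  have hww : w = w' := by
    funext i
    by_cases hi : ∀ j, j ≠ i → γ t j ≠ γ t i
    · rw [hf i hi, hf' i (by rwa [← ht])]
    · push Not at hi
      obtain ⟨j, hji, he⟩ := hi
      rcases lt_or_gt_of_ne hji with hlt | hlt
      · exact (pair j i hlt he).2
      · exact (pair i j hlt he.symm).1
  subst hww
  filter_upwards [eventually_all.2 hw, eventually_all.2 hw'] with s h1 h2
  funext i
  rw [h1, h2, ht]

theorem IsElasticMotion.eventually_left (hm : ∀ i, 0 < m i) (h : IsElasticMotion m γ)
    (h' : IsElasticMotion m γ') {t : ℝ} (ht : γ t = γ' t)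
    (hr : ∀ᶠ s in 𝓝[>] t, γ s = γ' s) : ∀ᶠ s in 𝓝[<] t, γ s = γ' s := by
  have h1 : ∀ᶠ s in 𝓝[<] (-t), γ (-s) = γ' (-s) := by
    have := (tendsto_neg_nhdsLT (a := -t))
    rw [neg_neg] at this
    exact this.eventually hr
  have h2 := h.reverse.eventually_right hm h'.reverse (t := -t) (by simpa using ht) h1
  have h3 := (tendsto_neg_nhdsLT (a := t)).eventually h2
  simpa using h3

/-- Both motions are affine on a left neighbourhood, so agreement at `t` and at one time in it
already equates the slopes. -/
theorem IsElasticMotion.eventually_left_of_frequently (h : IsElasticMotion m γ)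
    (h' : IsElasticMotion m γ') {t : ℝ} (hl : ∃ᶠ s in 𝓝[<] t, γ s = γ' s) :
    ∀ᶠ s in 𝓝[<] t, γ s = γ' s := by
  have ht : γ t = γ' t := by
    have hcl : IsClosed {s | γ s = γ' s} := isClosed_eq h.continuous h'.continuous
    exact hcl.mem_of_frequently_of_tendsto (hl.filter_mono nhdsWithin_le_nhds) tendsto_id
  obtain ⟨u, w, hu, -, -, -⟩ := h.elastic t
  obtain ⟨u', w', hu', -, -, -⟩ := h'.elastic t
  have huu : u = u' := by
    funext i
    obtain ⟨s, hs, ⟨h1, h2⟩, h3⟩ := (hl.and_eventually (((hu i).and (hu' i)).and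
      (eventually_mem_nhdsWithin (a := t) (s := Iio t)))).exists
    have hs' : s < t := h3
    rw [hs, h2, ht] at h1
    have : (s - t) * u i = (s - t) * u' i := by linarith
    exact mul_left_cancel₀ (sub_ne_zero.2 hs'.ne) this
  subst huu
  filter_upwards [eventually_all.2 hu, eventually_all.2 hu'] with s h1 h2
  funext i
  rw [h1, h2, ht]

/-- The times at which the germs coincide form an open and closed set. At a limit of such times the
germs agree on one side, and the collision law, read forwards or in reversed time, carries the
agreement across. -/
theorem IsElasticMotion.eq_of_eventuallyEq (hm : ∀ i, 0 < m i) (h : IsElasticMotion m γ)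
    (h' : IsElasticMotion m γ') {t₀ : ℝ} (h0 : ∀ᶠ s in 𝓝 t₀, γ s = γ' s) : γ = γ' := by
  have mem : ∀ t, γ t = γ' t → (∀ᶠ s in 𝓝[<] t, γ s = γ' s) → ∀ᶠ s in 𝓝 t, γ s = γ' s := by
    intro t ht hl
    have hr := h.eventually_right hm h' ht hl
    rw [← nhdsNE_sup_pure, eventually_sup, ← nhdsLT_sup_nhdsGT, eventually_sup]
    exact ⟨⟨hl, hr⟩, by simpa using ht⟩
  have hcl : IsClosed {s | γ s = γ' s} := isClosed_eq h.continuous h'.continuous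
  have hE : IsClopen {t | ∀ᶠ s in 𝓝 t, γ s = γ' s} := by
    refine ⟨isClosed_iff_frequently.2 fun t hfr => ?_, isOpen_setOfPred_eventually_nhds⟩
    have hfr' : ∃ᶠ s in 𝓝 t, γ s = γ' s := hfr.mono fun s hs => hs.self_of_nhds
    have ht : γ t = γ' t := hcl.mem_of_frequently_of_tendsto hfr' tendsto_id
    by_cases hmem : ∀ᶠ s in 𝓝 t, γ s = γ' s
    · exact hmem
    have hne : ∃ᶠ s in 𝓝[≠] t, γ s = γ' s := by
      rw [← nhdsNE_sup_pure, frequently_sup] at hfr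
      rcases hfr with hfr | hfr
      · exact hfr.mono fun s hs => hs.self_of_nhds
      · exact absurd (by simpa using hfr) hmem
    rw [← nhdsLT_sup_nhdsGT, frequently_sup] at hne
    rcases hne with hne | hne
    · exact mem t ht (h.eventually_left_of_frequently h' hne)
    · have h1 : ∃ᶠ s in 𝓝[<] (-t), γ (-s) = γ' (-s) := by
        have h2 : ∃ᶠ s in 𝓝[>] t, γ (-(-s)) = γ' (-(-s)) := by simpa using hne
        exact (tendsto_neg_nhdsGT (a := t)).frequently h2
      have h2 := h.reverse.eventually_left_of_frequently h'.reverse h1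
      have h3 := (tendsto_neg_nhdsGT (a := t)).eventually h2
      simp only [neg_neg] at h3
      exact mem t ht (h.eventually_left hm h' ht h3)
  have huniv := hE.eq_univ ⟨t₀, h0⟩
  funext t
  have ht : ∀ᶠ s in 𝓝 t, γ s = γ' s := by
    change t ∈ {t | ∀ᶠ s in 𝓝 t, γ s = γ' s}
    rw [huniv]
    exact mem_univ t
  exact ht.self_of_nhds

theorem IsElasticMotion.eventually_of_hasInitialData (h : IsElasticMotion m γ)
    {x : (Fin n → ℝ) × (Fin n → ℝ)} (hγ : HasInitialData x γ) :
    ∀ᶠ s in 𝓝[<] (0 : ℝ), γ s = fun i => x.1 i + s * x.2 i := by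
  obtain ⟨u, w, hu, hw, hf, -⟩ := h.elastic 0
  have huv : u = x.2 := by
    funext i
    have h1 : HasDerivWithinAt (fun t => γ t i) (x.2 i) (Iio 0) 0 := (hγ.2 i).hasDerivWithinAt
    have h2 : HasDerivWithinAt (fun t : ℝ => γ 0 i + (t - 0) * u i) (u i) (Iio 0) 0 := by
      have := (((hasDerivAt_id (0 : ℝ)).sub_const 0).mul_const (u i)).const_add (γ 0 i)
      simpa using this.hasDerivWithinAt (s := Iio 0)
    have h3 := h2.congr_of_eventuallyEq (hu i) (by simp)
    exact (uniqueDiffWithinAt_Iio (0 : ℝ)).eq_deriv _ h3 h1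
  filter_upwards [eventually_all.2 hu] with s hs
  funext i
  rw [hs, huv, hγ.1, sub_zero]

theorem IsElasticMotion.unique (hm : ∀ i, 0 < m i) (h : IsElasticMotion m γ)
    (h' : IsElasticMotion m γ') {x : (Fin n → ℝ) × (Fin n → ℝ)}
    (hγ : HasInitialData x γ) (hγ' : HasInitialData x γ') : γ = γ' := by
  have hl : ∀ᶠ s in 𝓝[<] (0 : ℝ), γ s = γ' s := by
    filter_upwards [h.eventually_of_hasInitialData hγ,
      h'.eventually_of_hasInitialData hγ'] with s h1 h2
    rw [h1, h2]
  have ht : γ 0 = γ' 0 := by rw [hγ.1, hγ'.1]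
  refine h.eq_of_eventuallyEq hm h' (t₀ := 0) ?_
  rw [← nhdsNE_sup_pure, eventually_sup, ← nhdsLT_sup_nhdsGT, eventually_sup]
  exact ⟨⟨hl, h.eventually_right hm h' ht hl⟩, by simpa using ht⟩

end Uniqueness

/-! ### Reflections and chains of simple collisions. -/

/-- The velocities after an elastic collision of the particles `i` and `i + 1`. -/
noncomputable def bounce (m : ℕ → ℝ) (i : ℕ) (y : ℕ → ℝ) : ℕ → ℝ := fun k =>
  if k = i then y i - 2 * m (i + 1) / (m i + m (i + 1)) * (y i - y (i + 1))
  else if k = i + 1 then y (i + 1) + 2 * m i / (m i + m (i + 1)) * (y i - y (i + 1))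
  else y k

/-- The first `n` terms of the sequence are strictly increasing. -/
def Ascending (n : ℕ) (y : ℕ → ℝ) : Prop := ∀ i, i + 1 < n → y i < y (i + 1)

/-- The state with positions `x` and velocities `v` of the particles `0, …, n - 1` with masses `m`
is reached after `k` simple collisions, and before these the velocities were strictly decreasing
and larger than `b`. -/
def Past (n : ℕ) (b : ℝ) : ℕ → (ℕ → ℝ) → (ℕ → ℝ) → (ℕ → ℝ) → Prop
  | 0, _, x, v => Ascending n x ∧ (∀ i, i + 1 < n → v (i + 1) < v i) ∧ ∀ i < n, b < v i
  | k + 1, m, x, v => Ascending n x ∧ ∃ i, i + 1 < n ∧ ∃ τ : ℝ, 0 < τ ∧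
      Past n b k m (bounce m i (x - τ • v)) (bounce m i v)

section Refl

variable {m : ℕ → ℝ} {i : ℕ} {y z : ℕ → ℝ}

theorem bounce_left : bounce m i y i =
    y i - 2 * m (i + 1) / (m i + m (i + 1)) * (y i - y (i + 1)) := by simp [bounce]

theorem bounce_right : bounce m i y (i + 1) =
    y (i + 1) + 2 * m i / (m i + m (i + 1)) * (y i - y (i + 1)) := by simp [bounce]

theorem bounce_of_ne {k : ℕ} (h : k ≠ i) (h' : k ≠ i + 1) : bounce m i y k = y k := by
  simp [bounce, h, h']

theorem bounce_sub_right (hm : m i + m (i + 1) ≠ 0) :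
    bounce m i y (i + 1) - bounce m i y i = y i - y (i + 1) := by
  rw [bounce_left, bounce_right]; field_simp; ring

theorem bounce_bounce (hm : m i + m (i + 1) ≠ 0) : bounce m i (bounce m i y) = y := by
  funext k
  have h := bounce_sub_right (y := y) hm
  by_cases h1 : k = i
  · subst h1
    rw [bounce_left, ← neg_sub (bounce m k y (k + 1)), h, bounce_left]; ring
  by_cases h2 : k = i + 1
  · subst h2
    rw [bounce_right, ← neg_sub (bounce m i y (i + 1)), h, bounce_right]; ring
  rw [bounce_of_ne h1 h2, bounce_of_ne h1 h2]

theorem bounce_add : bounce m i (y + z) = bounce m i y + bounce m i z := by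
  funext k
  simp only [bounce, Pi.add_apply]
  split_ifs <;> ring

theorem bounce_smul (c : ℝ) : bounce m i (c • y) = c • bounce m i y := by
  funext k
  simp only [bounce, Pi.smul_apply, smul_eq_mul]
  split_ifs <;> ring

theorem bounce_sub : bounce m i (y - z) = bounce m i y - bounce m i z := by
  funext k
  simp only [bounce, Pi.sub_apply]
  split_ifs <;> ring

theorem bounce_of_eq (h : y i = y (i + 1)) : bounce m i y = y := by
  funext k
  simp only [bounce, h, sub_self, mul_zero, sub_zero, add_zero]
  split_ifs with h1 h2
  · rw [h1, h]
  · rw [h2]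
  · rfl

theorem bounce_congr {m' : ℕ → ℝ} {n : ℕ} (hi : i + 1 < n) (hm : ∀ k < n, m k = m' k)
    (hy : ∀ k < n, y k = z k) : ∀ k < n, bounce m i y k = bounce m' i z k := by
  intro k hk
  simp only [bounce, hm i (by omega), hm _ hi, hy i (by omega), hy _ hi, hy k hk]

theorem continuous_bounce : Continuous (bounce m i) := by
  refine continuous_pi fun k => ?_
  simp only [bounce]
  split_ifs <;> fun_prop

theorem continuousAt_bounce (hm : m i + m (i + 1) ≠ 0) :
    ContinuousAt (fun p : (ℕ → ℝ) × (ℕ → ℝ) => bounce p.1 i p.2) (m, y) := by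
  refine continuousAt_pi.2 fun k => ?_
  simp only [bounce]
  split_ifs <;> fun_prop (disch := assumption)

end Refl

theorem Ascending.lt {n : ℕ} {y : ℕ → ℝ} (h : Ascending n y) {i j : ℕ} (hij : i < j)
    (hj : j < n) : y i < y j := by
  induction j, hij using Nat.le_induction with
  | base => exact h i hj
  | succ j hij ih => exact (ih (by omega)).trans (h j hj)

theorem Ascending.eventually {X : Type*} [TopologicalSpace X] {n : ℕ} {f : X → ℕ → ℝ} {p : X}
    {F : Filter X} (hF : F ≤ 𝓝 p)
    (hf : ContinuousAt f p) (h : Ascending n (f p)) : ∀ᶠ q in F, Ascending n (f q) := by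
  have : ∀ᶠ q in 𝓝 p, ∀ i ∈ Finset.range (n - 1), f q i < f q (i + 1) := by
    rw [Finset.eventually_all]
    intro i hi
    have hi' := Finset.mem_range.1 hi
    exact (continuousAt_pi.1 hf i).eventually_lt (continuousAt_pi.1 hf (i + 1)) (h i (by omega))
  filter_upwards [hF this] with q hq i hi
  exact hq i (Finset.mem_range.2 (by omega))

theorem Past.ascending {n : ℕ} {b : ℝ} {k : ℕ} {m x v : ℕ → ℝ} (h : Past n b k m x v) :
    Ascending n x := by
  cases k <;> exact h.1

theorem Past.congr {n : ℕ} {b : ℝ} {k : ℕ} {m x v m' x' v' : ℕ → ℝ} (h : Past n b k m x v)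
    (hm : ∀ i < n, m i = m' i) (hx : ∀ i < n, x i = x' i) (hv : ∀ i < n, v i = v' i) :
    Past n b k m' x' v' := by
  have asc : Ascending n x' := fun i hi => by
    rw [← hx i (by omega), ← hx _ hi]; exact h.ascending i hi
  induction k generalizing x v x' v' with
  | zero =>
    refine ⟨asc, fun i hi => ?_, fun i hi => ?_⟩
    · rw [← hv i (by omega), ← hv _ hi]; exact h.2.1 i hi
    · rw [← hv i hi]; exact h.2.2 i hi
  | succ k ih =>
    obtain ⟨-, i, hi, τ, hτ, hp⟩ := h
    have e : ∀ j < n, bounce m i (x - τ • v) j = bounce m' i (x' - τ • v') j :=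
      bounce_congr hi hm fun j hj => by simp [hx j hj, hv j hj]
    refine ⟨asc, i, hi, τ, hτ, ih hp e (bounce_congr hi hm hv) fun j hj => ?_⟩
    rw [← e j (by omega), ← e _ hj]
    exact hp.ascending j hj

/-- The same colliding pairs and the same durations `τ` serve for all nearby data: the earlier
states depend continuously on the present one, and every condition on them is strict. The collision
times themselves are not recorded and may move freely within their steps. -/
theorem Past.eventually {n : ℕ} {b : ℝ} {k : ℕ} {m x v : ℕ → ℝ} (hm : ∀ i, 0 < m i)
    (h : Past n b k m x v) :
    ∀ᶠ p : (ℕ → ℝ) × (ℕ → ℝ) × (ℕ → ℝ) in 𝓝 (m, x, v), Past n b k p.1 p.2.1 p.2.2 := by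
  have asc : ∀ᶠ p : (ℕ → ℝ) × (ℕ → ℝ) × (ℕ → ℝ) in 𝓝 (m, x, v), Ascending n p.2.1 :=
    Ascending.eventually le_rfl (by fun_prop) h.ascending
  induction k generalizing x v with
  | zero =>
    have h1 : ∀ᶠ p : (ℕ → ℝ) × (ℕ → ℝ) × (ℕ → ℝ) in 𝓝 (m, x, v), Ascending n (-p.2.2) :=
      Ascending.eventually le_rfl (by fun_prop) fun i hi => neg_lt_neg (h.2.1 i hi)
    have h2 : ∀ᶠ p : (ℕ → ℝ) × (ℕ → ℝ) × (ℕ → ℝ) in 𝓝 (m, x, v),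
        ∀ i ∈ Finset.range n, b < p.2.2 i := by
      rw [Finset.eventually_all]
      intro i hi
      exact ContinuousAt.eventually_lt (by fun_prop) (by fun_prop) (h.2.2 i (by simpa using hi))
    filter_upwards [asc, h1, h2] with p h0 h1 h2
    exact ⟨h0, fun i hi => neg_lt_neg_iff.1 (h1 i hi), fun i hi => h2 i (by simpa using hi)⟩
  | succ k ih =>
    obtain ⟨-, i, hi, τ, hτ, hp⟩ := h
    have hmi : m i + m (i + 1) ≠ 0 := (add_pos (hm _) (hm _)).ne'
    have hc : ContinuousAt (fun p : (ℕ → ℝ) × (ℕ → ℝ) × (ℕ → ℝ) =>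
        (p.1, bounce p.1 i (p.2.1 - τ • p.2.2), bounce p.1 i p.2.2)) (m, x, v) := by
      refine continuousAt_fst.prodMk (ContinuousAt.prodMk ?_ ?_)
      · exact ContinuousAt.comp (f := fun p : (ℕ → ℝ) × (ℕ → ℝ) × (ℕ → ℝ) =>
          (p.1, p.2.1 - τ • p.2.2)) (continuousAt_bounce hmi) (by fun_prop)
      · exact ContinuousAt.comp (f := fun p : (ℕ → ℝ) × (ℕ → ℝ) × (ℕ → ℝ) =>
          (p.1, p.2.2)) (continuousAt_bounce hmi) (by fun_prop)
    have := hc.eventually (ih hp (Ascending.eventually le_rfl (by fun_prop) hp.ascending))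
    filter_upwards [asc, this] with p h0 h1
    exact ⟨h0, i, hi, τ, hτ, h1⟩

/-! ### From a chain of collisions to a motion on the whole time axis. -/

/-- Around the time `t` the curve `γ` is an elastic motion. -/
def ElasticAt {n : ℕ} (m : Fin n → ℝ) (γ : ℝ → Fin n → ℝ) (t : ℝ) : Prop :=
  Monotone (γ t) ∧ (∀ i j k, i < j → j < k → ¬ (γ t i = γ t j ∧ γ t j = γ t k)) ∧
    ∃ u w : Fin n → ℝ,
    (∀ i, ∀ᶠ s in 𝓝[<] t, γ s i = γ t i + (s - t) * u i) ∧
    (∀ i, ∀ᶠ s in 𝓝[>] t, γ s i = γ t i + (s - t) * w i) ∧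
    (∀ i, (∀ j, j ≠ i → γ t j ≠ γ t i) → w i = u i) ∧
    (∀ i j, i < j → γ t i = γ t j →
      m i * w i + m j * w j = m i * u i + m j * u j ∧
      m i * w i ^ 2 / 2 + m j * w j ^ 2 / 2 = m i * u i ^ 2 / 2 + m j * u j ^ 2 / 2)

section ElasticAt

variable {n : ℕ} {m : Fin n → ℝ} {γ γ' : ℝ → Fin n → ℝ} {t : ℝ}

theorem isElasticMotion_of_elasticAt (h : ∀ t, ElasticAt m γ t) : IsElasticMotion m γ :=
  ⟨fun t => (h t).1, fun t => (h t).2.1, fun t => (h t).2.2⟩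

theorem ElasticAt.congr (h : ElasticAt m γ t) (he : ∀ᶠ s in 𝓝 t, γ s = γ' s) :
    ElasticAt m γ' t := by
  obtain ⟨h1, h2, u, w, hu, hw, h3⟩ := h
  have ht := he.self_of_nhds
  rw [ht] at h1 h2 h3 hu hw
  refine ⟨h1, h2, u, w, fun i => ?_, fun i => ?_, h3⟩
  · filter_upwards [hu i, nhdsWithin_le_nhds he] with s hs hs'
    rw [← hs', hs]
  · filter_upwards [hw i, nhdsWithin_le_nhds he] with s hs hs'
    rw [← hs', hs]

theorem ElasticAt.shift {τ : ℝ} (h : ElasticAt m γ (t + τ)) :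
    ElasticAt m (fun s => γ (s + τ)) t := by
  obtain ⟨h1, h2, u, w, hu, hw, h3⟩ := h
  have hc : Tendsto (fun s : ℝ => s + τ) (𝓝 t) (𝓝 (t + τ)) := by
    apply Continuous.tendsto; fun_prop
  have hl : Tendsto (fun s : ℝ => s + τ) (𝓝[<] t) (𝓝[<] (t + τ)) :=
    tendsto_nhdsWithin_iff.2 ⟨hc.mono_left nhdsWithin_le_nhds,
      eventually_mem_nhdsWithin.mono fun s hs => add_lt_add_left (show s < t from hs) τ⟩
  have hr : Tendsto (fun s : ℝ => s + τ) (𝓝[>] t) (𝓝[>] (t + τ)) :=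
    tendsto_nhdsWithin_iff.2 ⟨hc.mono_left nhdsWithin_le_nhds,
      eventually_mem_nhdsWithin.mono fun s hs => add_lt_add_left (show t < s from hs) τ⟩
  refine ⟨h1, h2, u, w, fun i => ?_, fun i => ?_, h3⟩
  · filter_upwards [hl.eventually (hu i)] with s hs
    rw [hs]; ring
  · filter_upwards [hr.eventually (hw i)] with s hs
    rw [hs]; ring

theorem elasticAt_line {x v : Fin n → ℝ} (h : StrictMono fun i => x i + t * v i) :
    ElasticAt m (fun s i => x i + s * v i) t := by
  refine ⟨h.monotone, fun i j k hij _ he => (h hij).ne he.1, v, v,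
    fun i => Eventually.of_forall fun s => by ring, fun i => Eventually.of_forall fun s => by ring,
    fun _ _ => rfl, fun i j hij he => absurd he (h hij).ne⟩

end ElasticAt

theorem Ascending.strictMono {n : ℕ} {y : ℕ → ℝ} (h : Ascending n y) :
    StrictMono fun i : Fin n => y i := fun _ j hij => h.lt hij j.2

theorem affine_pos {a b s t r : ℝ} (hs : 0 < a + s * b) (ht : 0 < a + t * b) (hsr : s ≤ r)
    (hrt : r ≤ t) : 0 < a + r * b := by
  rcases le_total 0 b with hb | hb
  · nlinarith [mul_le_mul_of_nonneg_right hsr hb]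
  · nlinarith [mul_le_mul_of_nonpos_right hrt hb]

theorem bounce_line {m x v : ℕ → ℝ} {i : ℕ} (t : ℝ) :
    bounce m i (x + t • v) = bounce m i x + t • bounce m i v := by
  rw [bounce_add, bounce_smul]

/-- Between the time `-τ` and the time `0` only the particles `i` and `i + 1` collide. -/
theorem exists_collision_time {n i : ℕ} {m x v : ℕ → ℝ} (hm : ∀ k, 0 < m k) (hi : i + 1 < n)
    {τ : ℝ} (hτ : 0 < τ) (hx : Ascending n x) (hy : Ascending n (bounce m i (x - τ • v))) :
    ∃ t₀, -τ < t₀ ∧ t₀ < 0 ∧ (x + t₀ • v) i = (x + t₀ • v) (i + 1) ∧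
      (∀ j, j + 1 < n → j ≠ i → (x + t₀ • v) j < (x + t₀ • v) (j + 1)) ∧
      (∀ t, t₀ < t → t ≤ 0 → Ascending n (x + t • v)) ∧
      (∀ t, -τ ≤ t → t < t₀ → Ascending n (bounce m i (x + t • v))) := by
  have hmi : m i + m (i + 1) ≠ 0 := (add_pos (hm _) (hm _)).ne'
  have hy' : Ascending n (bounce m i (x + (-τ) • v)) := by rwa [neg_smul, ← sub_eq_add_neg]
  have hd0 : x i < x (i + 1) := hx i hi
  have hd1 : x (i + 1) - τ * v (i + 1) < x i - τ * v i := by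
    have h1 := hy i hi
    have h2 := bounce_sub_right (y := x - τ • v) hmi
    simp only [Pi.sub_apply, Pi.smul_apply, smul_eq_mul] at h2
    linarith
  have hvi : 0 < v (i + 1) - v i := by
    by_contra hcon
    nlinarith [not_lt.1 hcon]
  obtain ⟨t₀, ht₀⟩ : ∃ t₀, t₀ * (v (i + 1) - v i) = -(x (i + 1) - x i) :=
    ⟨-(x (i + 1) - x i) / (v (i + 1) - v i), div_mul_cancel₀ _ hvi.ne'⟩
  have hlt : -τ < t₀ := by
    by_contra hcon
    nlinarith [mul_le_mul_of_nonneg_right (not_lt.1 hcon) hvi.le]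
  have hlt0 : t₀ < 0 := by
    by_contra hcon
    nlinarith [mul_nonneg (not_lt.1 hcon) hvi.le]
  have heq : (x + t₀ • v) i = (x + t₀ • v) (i + 1) := by
    simp only [Pi.add_apply, Pi.smul_apply, smul_eq_mul]; linarith
  have hfix := bounce_of_eq (m := m) heq
  have haff : ∀ (x v : ℕ → ℝ) (t : ℝ) (j : ℕ), (x + t • v) j < (x + t • v) (j + 1) ↔
      0 < (x (j + 1) - x j) + t * (v (j + 1) - v j) := by
    intro x v t j
    simp only [Pi.add_apply, Pi.smul_apply, smul_eq_mul]
    constructor <;> intro h <;> linarith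
  -- At time `-τ` the unfolded line has `i` and `i + 1` in the wrong order. The reflection moves
  -- them towards each other's side, which only narrows the gaps to their outer neighbours; those
  -- gaps are thus positive on the unfolded line as well.
  have hend : ∀ j, j + 1 < n → j ≠ i → (x + (-τ) • v) j < (x + (-τ) • v) (j + 1) := by
    intro j hj hji
    have h1 := hy' j hj
    have hpos : 0 < (x + (-τ) • v) i - (x + (-τ) • v) (i + 1) := by
      simp only [Pi.add_apply, Pi.smul_apply, smul_eq_mul]; linarith
    by_cases h2 : j + 1 = i
    · subst h2
      rw [bounce_left, bounce_of_ne (by omega) (by omega)] at h1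
      refine h1.trans (sub_lt_self _ (mul_pos ?_ hpos))
      have := hm (j + 1); have := hm (j + 1 + 1); positivity
    · by_cases h3 : j = i + 1
      · subst h3
        rw [bounce_right, bounce_of_ne (by omega) (by omega)] at h1
        refine lt_trans (lt_add_of_pos_right _ (mul_pos ?_ hpos)) h1
        have := hm i; have := hm (i + 1); positivity
      · rwa [bounce_of_ne (by omega) (by omega), bounce_of_ne (by omega) (by omega)] at h1
  have hmid : ∀ t, -τ ≤ t → t ≤ 0 → ∀ j, j + 1 < n → j ≠ i →
      (x + t • v) j < (x + t • v) (j + 1) := by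
    intro t h1 h2 j hj hji
    rw [haff]
    refine affine_pos (s := -τ) (t := 0) ((haff _ _ _ _).1 (hend j hj hji)) ?_ h1 h2
    simpa using hx j hj
  refine ⟨t₀, hlt, hlt0, heq, fun j hj hji => hmid t₀ hlt.le hlt0.le j hj hji,
    fun t h1 h2 j hj => ?_, fun t h1 h2 j hj => ?_⟩
  · by_cases hji : j = i
    · subst hji
      rw [haff]
      nlinarith [mul_lt_mul_of_pos_right h1 hvi]
    · exact hmid t (hlt.le.trans h1.le) h2 j hj hji
  · by_cases hji : j = i
    · subst hji
      rw [← sub_pos, bounce_sub_right hmi]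
      simp only [Pi.add_apply, Pi.smul_apply, smul_eq_mul]
      nlinarith [mul_lt_mul_of_pos_right h2 hvi]
    · rw [bounce_line, haff]
      -- The gaps of the reflected line are affine in time, positive at `-τ` by assumption, and at
      -- `t₀` because the reflection fixes the configuration there.
      refine affine_pos (s := -τ) (t := t₀) ?_ ?_ h1 h2.le
      · rw [← haff, ← bounce_line]; exact hy' j hj
      · rw [← haff, ← bounce_line, hfix]; exact hmid t₀ hlt.le hlt0.le j hj hji

theorem elasticAt_collision {n i : ℕ} {m x v : ℕ → ℝ} (hm : ∀ k, 0 < m k) (hi : i + 1 < n)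
    {γ : ℝ → Fin n → ℝ} {t₀ : ℝ} (heq : (x + t₀ • v) i = (x + t₀ • v) (i + 1))
    (hlt : ∀ j, j + 1 < n → j ≠ i → (x + t₀ • v) j < (x + t₀ • v) (j + 1))
    (hr : ∀ t, t₀ ≤ t → ∀ j, γ t j = (x + t • v) j)
    (hl : ∀ᶠ t in 𝓝[<] t₀, ∀ j, γ t j = bounce m i (x + t • v) j) :
    ElasticAt (fun k : Fin n => m k) γ t₀ ∧
      ∀ a b : Fin n, a < b → γ t₀ a = γ t₀ b → (a : ℕ) = i ∧ (b : ℕ) = i + 1 := by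
  have hmi : 0 < m i + m (i + 1) := add_pos (hm _) (hm _)
  have hmi' := hmi.ne'
  set y := x + t₀ • v with hy
  have hγ : ∀ j : Fin n, γ t₀ j = y j := hr t₀ le_rfl
  have hle : ∀ a b : ℕ, a ≤ b → b < n → y a ≤ y b := by
    intro a b hab
    induction b, hab using Nat.le_induction with
    | base => intro _; exact le_rfl
    | succ b hab ih =>
      intro hb
      refine (ih (by omega)).trans ?_
      by_cases hbi : b = i
      · subst hbi; exact heq.le
      · exact (hlt b hb hbi).le
  have honly : ∀ a b : ℕ, a < b → b < n → y a = y b → a = i ∧ b = i + 1 := by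
    intro a b hab hb he
    have hai : a = i := by
      by_contra hai
      exact absurd he (((hlt a (by omega) hai).trans_le (hle _ _ hab hb)).ne)
    refine ⟨hai, ?_⟩
    by_contra hbi
    obtain ⟨c, rfl⟩ : ∃ c, b = c + 1 := ⟨b - 1, by omega⟩
    exact absurd he (((hle a c (by omega) (by omega)).trans_lt (hlt c hb (by omega))).ne)
  have honly' : ∀ a b : Fin n, a < b → γ t₀ a = γ t₀ b → (a : ℕ) = i ∧ (b : ℕ) = i + 1 := by
    intro a b hab he
    rw [hγ, hγ] at he
    exact honly a b hab b.2 he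
  refine ⟨⟨?_, ?_, fun k => bounce m i v k, fun k => v k, ?_, ?_, ?_, ?_⟩, honly'⟩
  · intro a b hab
    rw [hγ, hγ]
    exact hle a b hab b.2
  · rintro a b c hab hbc ⟨h1, h2⟩
    have := (honly' a b hab h1).2
    have := (honly' b c hbc h2).1
    omega
  · intro j
    filter_upwards [hl] with t ht
    have h1 : x + t • v = y + (t - t₀) • v := by rw [hy, sub_smul]; abel
    rw [ht, hγ, h1, bounce_line, bounce_of_eq heq]
    simp
  · intro j
    filter_upwards [self_mem_nhdsWithin] with t ht
    rw [hr t (le_of_lt ht), hγ, hy]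
    simp only [Pi.add_apply, Pi.smul_apply, smul_eq_mul]
    ring
  · intro j hj
    by_cases h1 : (j : ℕ) = i
    · refine absurd ?_ (hj ⟨i + 1, hi⟩ (by intro h; have := congrArg Fin.val h; simp at this; omega))
      rw [hγ, hγ, h1, ← heq]
    by_cases h2 : (j : ℕ) = i + 1
    · refine absurd ?_ (hj ⟨i, by omega⟩
        (by intro h; have := congrArg Fin.val h; simp at this; omega))
      rw [hγ, hγ, h2, ← heq]
    exact (bounce_of_ne h1 h2).symm
  · intro a b hab he
    obtain ⟨h1, h2⟩ := honly' a b hab he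
    simp only [h1, h2]
    rw [bounce_left, bounce_right]
    constructor <;> field_simp <;> ring

/-- The motion for the shorter chain is shifted in time by `τ` and replaced from the collision time
on by the straight line. The margin `ε` makes it agree with its final line on both sides of the
joining time, so that the germs match there. -/
theorem Past.exists_motion {n : ℕ} {b : ℝ} {k : ℕ} {m x v : ℕ → ℝ} (hm : ∀ k, 0 < m k)
    (h : Past n b k m x v) :
    ∃ γ : ℝ → Fin n → ℝ, (∃ ε > 0, ∀ t > -ε, ∀ j, γ t j = (x + t • v) j) ∧
      (∀ t < 0, ElasticAt (fun k : Fin n => m k) γ t) ∧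
      {c ∈ collisions γ | c.1 < 0}.encard = k := by
  induction k generalizing x v with
  | zero =>
    obtain ⟨hx, hv, -⟩ := h
    have asc : ∀ t ≤ (0 : ℝ), Ascending n (x + t • v) := by
      intro t ht i hi
      simp only [Pi.add_apply, Pi.smul_apply, smul_eq_mul]
      nlinarith [hx i hi, mul_le_mul_of_nonpos_left (hv i hi).le ht]
    refine ⟨fun t j => x j + t * v j, ⟨1, one_pos, fun t _ j => by simp⟩, fun t ht => ?_, ?_⟩
    · exact elasticAt_line (asc t ht.le).strictMono
    · rw [Nat.cast_zero, encard_eq_zero, eq_empty_iff_forall_notMem]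
      rintro ⟨t, i, j⟩ ⟨⟨hij, he⟩, ht⟩
      exact ((asc t (le_of_lt ht)).strictMono hij).ne he
  | succ k ih =>
    obtain ⟨hx, i, hi, τ, hτ, hp⟩ := h
    obtain ⟨t₀, hτt, ht0, heq, hlt, hright, hleft⟩ :=
      exists_collision_time hm hi hτ hx hp.ascending
    obtain ⟨γ, ⟨ε, hε, hγ⟩, hel, hcard⟩ := ih hp
    have hγ' : ∀ t > -τ - ε, ∀ j, γ (t + τ) j = bounce m i (x + t • v) j := by
      intro t ht j
      have e : x - τ • v + (t + τ) • v = x + t • v := by rw [add_smul]; abel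
      rw [hγ (t + τ) (by linarith), ← bounce_line, e]
    set Γ : ℝ → Fin n → ℝ := fun t => if t₀ ≤ t then fun j => (x + t • v) j else γ (t + τ) with hΓ
    have hΓr : ∀ t, t₀ ≤ t → ∀ j, Γ t j = (x + t • v) j := fun t ht j => by
      simp only [hΓ, if_pos ht]
    have hΓl : ∀ t, t < t₀ → Γ t = γ (t + τ) := fun t ht => by
      simp only [hΓ, if_neg (not_le.2 ht)]
    have hcoll := elasticAt_collision (γ := Γ) hm hi heq hlt hΓr (by
      filter_upwards [Ioo_mem_nhdsLT hτt] with t ht j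
      rw [hΓl t ht.2, hγ' t (by linarith [ht.1])])
    refine ⟨Γ, ⟨-t₀, by linarith, fun t ht j => hΓr t (by linarith) j⟩, fun t ht => ?_, ?_⟩
    · rcases lt_trichotomy t t₀ with h1 | h1 | h1
      · have h2 : ∀ᶠ s in 𝓝 t, γ (s + τ) = Γ s := by
          filter_upwards [Iio_mem_nhds h1] with s hs
          rw [hΓl s hs]
        refine ElasticAt.congr ?_ h2
        rcases lt_or_ge t (-τ) with h3 | h3
        · exact (hel (t + τ) (by linarith)).shift
        · have h4 := (hleft t h3 h1).strictMono
          rw [bounce_line] at h4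
          refine ElasticAt.congr (elasticAt_line h4) ?_
          filter_upwards [Ioi_mem_nhds (show -τ - ε < t by linarith)] with s hs
          funext j
          rw [hγ' s hs, bounce_line]
          simp
      · rw [h1]; exact hcoll.1
      · have h2 := (hright t h1 ht.le).strictMono
        refine ElasticAt.congr (elasticAt_line h2) ?_
        filter_upwards [Ioi_mem_nhds h1] with s hs
        funext j
        rw [hΓr s (le_of_lt hs)]
        simp
    · have hset : {c ∈ collisions Γ | c.1 < 0} =
          insert (t₀, (⟨i, by omega⟩ : Fin n), (⟨i + 1, hi⟩ : Fin n))
            ((fun c : ℝ × Fin n × Fin n => (c.1 - τ, c.2)) '' {c ∈ collisions γ | c.1 < 0}) := by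
        ext ⟨t, p, q⟩
        simp only [collisions, mem_ofPred_eq, mem_insert_iff, mem_image, Prod.mk.injEq, Prod.exists]
        constructor
        · rintro ⟨⟨hpq, he⟩, ht⟩
          rcases lt_trichotomy t t₀ with h1 | h1 | h1
          · right
            rw [hΓl t h1] at he
            refine ⟨t + τ, p, q, ⟨⟨hpq, he⟩, ?_⟩, by ring, rfl, rfl⟩
            by_contra h3
            rw [hγ' t (by linarith), hγ' t (by linarith)] at he
            exact ((hleft t (by linarith) h1).strictMono hpq).ne he
          · left
            rw [h1] at he
            obtain ⟨h2, h3⟩ := hcoll.2 p q hpq he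
            exact ⟨h1, Fin.ext h2, Fin.ext h3⟩
          · rw [hΓr t h1.le, hΓr t h1.le] at he
            exact absurd he ((hright t h1 ht.le).strictMono hpq).ne
        · rintro (⟨rfl, rfl, rfl⟩ | ⟨s, p', q', ⟨⟨hpq, he⟩, hs⟩, rfl, rfl, rfl⟩)
          · refine ⟨⟨by simp [Fin.lt_def], ?_⟩, ht0⟩
            rw [hΓr _ le_rfl, hΓr _ le_rfl]
            exact heq
          · refine ⟨⟨hpq, ?_⟩, by linarith⟩
            rw [hΓl _ (by linarith), sub_add_cancel]
            exact he
      rw [hset, encard_insert_of_notMem, Function.Injective.encard_image, hcard]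
      · push_cast; rfl
      · rintro ⟨s, c⟩ ⟨s', c'⟩ h
        simp only [Prod.mk.injEq, sub_left_inj] at h
        rw [h.1, h.2]
      · rintro ⟨⟨s, p, q⟩, ⟨-, hs⟩, h⟩
        simp only [Prod.mk.injEq] at h hs
        linarith [h.1]

/-- With increasing velocities the gaps grow for ever, so no collision happens from time `0` on. -/
theorem Past.hasCollisionNumber {n : ℕ} {b : ℝ} {k : ℕ} {m x v : ℕ → ℝ} (hm : ∀ k, 0 < m k)
    (h : Past n b k m x v) (hv : Ascending n v) :
    HasCollisionNumber (fun i : Fin n => m i) (fun i : Fin n => x i, fun i : Fin n => v i) k := by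
  obtain ⟨γ, ⟨ε, hε, hγ⟩, hel, hcard⟩ := h.exists_motion hm
  have asc : ∀ t ≥ (0 : ℝ), Ascending n (x + t • v) := by
    intro t ht i hi
    simp only [Pi.add_apply, Pi.smul_apply, smul_eq_mul]
    nlinarith [h.ascending i hi, mul_le_mul_of_nonneg_left (hv i hi).le ht]
  have hE : IsElasticMotion (fun i : Fin n => m i) γ := isElasticMotion_of_elasticAt fun t => by
    rcases lt_or_ge t 0 with ht | ht
    · exact hel t ht
    · refine ElasticAt.congr (elasticAt_line (asc t ht).strictMono) ?_
      filter_upwards [Ioi_mem_nhds (show -ε < t by linarith)] with s hs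
      funext j
      rw [hγ s hs]
      simp
  have hI : HasInitialData (fun i : Fin n => x i, fun i : Fin n => v i) γ := by
    refine ⟨funext fun i => by rw [hγ 0 (by linarith)]; simp, fun i => ?_⟩
    have h1 : HasDerivAt (fun t : ℝ => x i + t * v i) (v i) 0 := by
      simpa using ((hasDerivAt_id (0 : ℝ)).mul_const (v i)).const_add (x i)
    refine h1.congr_of_eventuallyEq ?_
    filter_upwards [Ioi_mem_nhds (show -ε < 0 by linarith)] with s hs
    rw [hγ s hs]
    simp
  refine ⟨γ, hE, hI, fun γ' hE' hI' => hE'.unique (fun i => hm i) hE hI' hI, ?_⟩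
  rw [← hcard]
  congr 1
  ext ⟨t, i, j⟩
  refine ⟨fun hc => ⟨hc, ?_⟩, fun hc => hc.1⟩
  by_contra ht
  have ht : 0 ≤ t := not_lt.1 ht
  obtain ⟨hij, he⟩ := hc
  simp only at hij he
  rw [hγ t (by linarith), hγ t (by linarith)] at he
  exact ((asc t ht).strictMono hij).ne he

theorem Past.existsOpenWithCollisions {n : ℕ} {b : ℝ} {k : ℕ} {m x v : ℕ → ℝ}
    (hm : ∀ k, 0 < m k) (h : Past n b k m x v) (hv : Ascending n v) {B : Set (Fin n → ℝ)}
    (hB : B ∈ 𝓝 fun i : Fin n => m i) : ExistsOpenWithCollisions B k := by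
  -- Entries from `n` on do not matter to `Past`; the filler is `1` for masses, to keep them
  -- positive, and `0` otherwise.
  let E : ℝ → (Fin n → ℝ) → ℕ → ℝ := fun c y j => if hj : j < n then y ⟨j, hj⟩ else c
  have hE : ∀ c, Continuous (E c) := fun c => continuous_pi fun j => by
    by_cases hj : j < n
    · simp only [E, dif_pos hj]; fun_prop
    · simp only [E, dif_neg hj]; fun_prop
  have hEr : ∀ c y (i : Fin n), E c y i = y i := fun c y i => by simp [E]
  have hEl : ∀ c (y : ℕ → ℝ), ∀ i < n, y i = E c (fun i : Fin n => y i) i := fun c y i hi => by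
    simp [E, hi]
  have hmE : ∀ y : Fin n → ℝ, (∀ i, 0 < y i) → ∀ k, 0 < E 1 y k := fun y hy k => by
    by_cases hk : k < n
    · simp only [E, dif_pos hk]; exact hy _
    · simp only [E, dif_neg hk]; exact one_pos
  set m₀ : Fin n → ℝ := fun i => m i
  set x₀ : Fin n → ℝ := fun i => x i
  set v₀ : Fin n → ℝ := fun i => v i
  have hP : Past n b k (E 1 m₀) (E 0 x₀) (E 0 v₀) := h.congr (hEl 1 m) (hEl 0 x) (hEl 0 v)
  have ev1 := hP.eventually (hmE m₀ fun i => hm i)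
  have hc : Continuous fun p : (Fin n → ℝ) × (Fin n → ℝ) × (Fin n → ℝ) =>
      (E 1 p.1, E 0 p.2.1, E 0 p.2.2) := by
    have := hE 0; have := hE 1; fun_prop
  have ev2 : ∀ᶠ p : (Fin n → ℝ) × (Fin n → ℝ) × (Fin n → ℝ) in 𝓝 (m₀, x₀, v₀),
      Past n b k (E 1 p.1) (E 0 p.2.1) (E 0 p.2.2) := (hc.tendsto (m₀, x₀, v₀)).eventually ev1
  have ev3 : ∀ᶠ p : (Fin n → ℝ) × (Fin n → ℝ) × (Fin n → ℝ) in 𝓝 (m₀, x₀, v₀),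
      Ascending n (E 0 p.2.2) :=
    Ascending.eventually le_rfl (by have := hE 0; fun_prop) (fun i hi => by
      rw [← hEl 0 v i (by omega), ← hEl 0 v _ hi]; exact hv i hi)
  have ev4 : ∀ᶠ p : (Fin n → ℝ) × (Fin n → ℝ) × (Fin n → ℝ) in 𝓝 (m₀, x₀, v₀), ∀ i, 0 < p.1 i :=
    eventually_all.2 fun i => ContinuousAt.eventually_lt (by fun_prop) (by fun_prop) (hm i)
  have ev5 : ∀ᶠ p : (Fin n → ℝ) × (Fin n → ℝ) × (Fin n → ℝ) in 𝓝 (m₀, x₀, v₀), p.1 ∈ B :=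
    continuousAt_fst.eventually hB
  have ev := ev2.and (ev3.and (ev4.and ev5))
  rw [nhds_prod_eq, eventually_prod_iff] at ev
  obtain ⟨P, hP1, Q, hQ1, hPQ⟩ := ev
  obtain ⟨W, hWP, hW, hmW⟩ := eventually_nhds_iff.1 hP1
  obtain ⟨U, hUQ, hU, hxU⟩ := eventually_nhds_iff.1 hQ1
  refine ⟨W, U, hW, ⟨m₀, hmW⟩, fun y hy => ?_, hU, ⟨_, hxU⟩, fun z hz => ?_, fun y hy z hz => ?_⟩
  · obtain ⟨-, -, h3, h4⟩ := hPQ (hWP y hy) (hUQ _ hxU)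
    exact ⟨h4, h3⟩
  · obtain ⟨h1, -⟩ := hPQ (hWP _ hmW) (hUQ _ hz)
    have := h1.ascending.strictMono
    simp only [hEr] at this
    exact this
  · obtain ⟨h1, h2, h3, -⟩ := hPQ (hWP _ hy) (hUQ _ hz)
    have := h1.hasCollisionNumber (hmE y h3) h2
    simp only [hEr] at this
    exact this

theorem Past.isOpen {n : ℕ} {b : ℝ} {k : ℕ} {m : ℕ → ℝ} (hm : ∀ k, 0 < m k) :
    IsOpen {s : (ℕ → ℝ) × (ℕ → ℝ) | Past n b k m s.1 s.2} :=
  isOpen_iff_eventually.2 fun s hs => by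
    have h2 : ContinuousAt (fun p : (ℕ → ℝ) × (ℕ → ℝ) => (m, p.1, p.2)) s := by fun_prop
    exact h2.eventually (Past.eventually hm hs)

/-! ### Sorting of velocities regardless of the positions. -/

/-- Every sequence of collisions of neighbours which approach each other sorts the velocities `v`
of the first `n` particles in exactly `φ` steps. -/
def Sorts (n : ℕ) (m : ℕ → ℝ) : ℕ → (ℕ → ℝ) → Prop
  | 0, v => Ascending n v
  | φ + 1, v => (∃ i, i + 1 < n ∧ v (i + 1) < v i) ∧
      ∀ i, i + 1 < n → v (i + 1) < v i → Sorts n m φ (bounce m i v)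

/-- Slightly moving a particle and all those to its right makes the next collision simple. -/
theorem exists_simple_collision {n : ℕ} {m : ℕ → ℝ} (hm : ∀ k, 0 < m k)
    {U : Set ((ℕ → ℝ) × (ℕ → ℝ))} (hU : IsOpen U) {x v : ℕ → ℝ} (hxv : (x, v) ∈ U)
    (hx : Ascending n x) (hv : ∃ i, i + 1 < n ∧ v (i + 1) < v i) :
    ∃ i, i + 1 < n ∧ v (i + 1) < v i ∧ ∃ x', (x', v) ∈ U ∧ ∃ τ : ℝ, 0 < τ ∧
      Ascending n (bounce m i (x' + τ • v)) := by
  classical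
  let D := (Finset.range n).filter fun i => i + 1 < n ∧ v (i + 1) < v i
  have hD : ∀ {i}, i ∈ D ↔ i + 1 < n ∧ v (i + 1) < v i := by
    intro i; simp only [D, Finset.mem_filter, Finset.mem_range]; constructor
    · exact fun h => h.2
    · exact fun h => ⟨by omega, h⟩
  obtain ⟨i, hiD, hmin⟩ := D.exists_min_image (fun j => (x (j + 1) - x j) / (v j - v (j + 1)))
    (hv.imp fun i hi => hD.2 hi)
  obtain ⟨hi, hvi⟩ := hD.1 hiD
  have hmi : m i + m (i + 1) ≠ 0 := (add_pos (hm _) (hm _)).ne'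
  -- The pair `i` has minimal collision time. The shift shortens its gap and no other, so that its
  -- collision becomes strictly the first.
  let X : ℝ → ℕ → ℝ := fun h j => if i < j then x j - h else x j
  have hX : Continuous X := continuous_pi fun j => by
    by_cases hj : i < j
    · simp only [X, if_pos hj]; fun_prop
    · simp only [X, if_neg hj]; fun_prop
  have hX0 : X 0 = x := by funext j; simp [X]
  have ev1 : ∀ᶠ h in 𝓝[>] (0 : ℝ), (X h, v) ∈ U := by
    have : ContinuousAt (fun h => (X h, v)) 0 := by fun_prop
    exact nhdsWithin_le_nhds (this.eventually
      (hU.mem_nhds (show (X 0, v) ∈ U by rwa [hX0])))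
  have ev2 : ∀ᶠ h in 𝓝[>] (0 : ℝ), Ascending n (X h) :=
    Ascending.eventually nhdsWithin_le_nhds hX.continuousAt (by rwa [hX0])
  obtain ⟨h, hh, hhU, hha⟩ := (eventually_mem_nhdsWithin.and (ev1.and ev2)).exists
  have hh : 0 < h := hh
  set x' := X h with hx'
  have hgap : x' (i + 1) - x' i = x (i + 1) - x i - h := by simp [hx', X]; ring
  have hgap' : ∀ j, j ≠ i → x' (j + 1) - x' j = x (j + 1) - x j := by
    intro j hj
    simp only [hx', X]
    split_ifs <;> first | omega | ring
  have hvi' : 0 < v i - v (i + 1) := sub_pos.2 hvi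
  set t := (x' (i + 1) - x' i) / (v i - v (i + 1)) with ht
  have ht' : t * (v i - v (i + 1)) = x' (i + 1) - x' i := div_mul_cancel₀ _ hvi'.ne'
  have ht0 : 0 < t := div_pos (sub_pos.2 (hha i hi)) hvi'
  have heq : (x' + t • v) i = (x' + t • v) (i + 1) := by
    simp only [Pi.add_apply, Pi.smul_apply, smul_eq_mul]; linarith
  have hother : ∀ j, j + 1 < n → j ≠ i → (x' + t • v) j < (x' + t • v) (j + 1) := by
    intro j hj hji
    simp only [Pi.add_apply, Pi.smul_apply, smul_eq_mul]
    rcases le_or_gt (v j) (v (j + 1)) with hle | hlt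
    · nlinarith [hha j hj, mul_le_mul_of_nonneg_left hle ht0.le]
    · have h1 : t < (x (j + 1) - x j) / (v j - v (j + 1)) := by
        refine lt_of_lt_of_le ?_ (hmin j (hD.2 ⟨hj, hlt⟩))
        rw [ht, hgap]
        exact div_lt_div_of_pos_right (by linarith) hvi'
      rw [lt_div_iff₀ (sub_pos.2 hlt), ← hgap' j hji] at h1
      linarith
  have ev3 : ∀ᶠ τ in 𝓝[>] t, ∀ j ∈ (Finset.range (n - 1)).erase i,
      bounce m i (x' + τ • v) j < bounce m i (x' + τ • v) (j + 1) := by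
    rw [Finset.eventually_all]
    intro j hj
    obtain ⟨hji, hj⟩ := Finset.mem_erase.1 hj
    have hj := Finset.mem_range.1 hj
    have hc : Continuous fun τ : ℝ => bounce m i (x' + τ • v) :=
      continuous_bounce.comp (by fun_prop)
    refine nhdsWithin_le_nhds (ContinuousAt.eventually_lt
      (continuous_pi_iff.1 hc j).continuousAt (continuous_pi_iff.1 hc (j + 1)).continuousAt ?_)
    rw [bounce_of_eq heq]
    exact hother j (by omega) hji
  obtain ⟨τ, hτ, hτ'⟩ := (eventually_mem_nhdsWithin.and ev3).exists
  have hτ : t < τ := hτ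
  refine ⟨i, hi, hvi, x', hhU, τ, ht0.trans hτ, fun j hj => ?_⟩
  by_cases hji : j = i
  · subst hji
    rw [← sub_pos, bounce_sub_right hmi]
    simp only [Pi.add_apply, Pi.smul_apply, smul_eq_mul]
    nlinarith [mul_lt_mul_of_pos_right hτ hvi']
  · exact hτ' j (Finset.mem_erase.2 ⟨hji, Finset.mem_range.2 (by omega)⟩)

/-- Openness allows positions to be perturbed before every collision. The new set is a preimage
under the step back in time, hence open again, and the process can be iterated. -/
theorem exists_isOpen_past_succ {n : ℕ} {b : ℝ} {k : ℕ} {m : ℕ → ℝ} (hm : ∀ k, 0 < m k)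
    {U : Set ((ℕ → ℝ) × (ℕ → ℝ))} (hU : IsOpen U) (hUP : ∀ s ∈ U, Past n b k m s.1 s.2)
    {s₀ : (ℕ → ℝ) × (ℕ → ℝ)} (hs₀ : s₀ ∈ U) (hv : ∃ i, i + 1 < n ∧ s₀.2 (i + 1) < s₀.2 i) :
    ∃ i, i + 1 < n ∧ ∃ U' : Set ((ℕ → ℝ) × (ℕ → ℝ)), IsOpen U' ∧ U'.Nonempty ∧
      ∀ s' ∈ U', Past n b (k + 1) m s'.1 s'.2 ∧
        ∃ s ∈ U, s.2 (i + 1) < s.2 i ∧ s'.2 = bounce m i s.2 := by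
  obtain ⟨x, v⟩ := s₀
  obtain ⟨i, hi, hvi, x', hx', τ, hτ, hasc⟩ :=
    exists_simple_collision hm hU hs₀ (hUP _ hs₀).ascending hv
  have hmi : m i + m (i + 1) ≠ 0 := (add_pos (hm _) (hm _)).ne'
  let G : (ℕ → ℝ) × (ℕ → ℝ) → (ℕ → ℝ) × (ℕ → ℝ) :=
    fun s => (bounce m i (s.1 - τ • s.2), bounce m i s.2)
  have hG : Continuous G := (continuous_bounce.comp (by fun_prop)).prodMk
    (continuous_bounce.comp (by fun_prop))
  refine ⟨i, hi, {s | Ascending n s.1} ∩ G ⁻¹' (U ∩ {s | s.2 (i + 1) < s.2 i}), ?_,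
    ⟨(bounce m i (x' + τ • v), bounce m i v), hasc, ?_⟩, ?_⟩
  · refine IsOpen.inter ?_ (IsOpen.preimage hG (hU.inter (isOpen_lt (by fun_prop) (by fun_prop))))
    exact isOpen_iff_eventually.2 fun s hs => Ascending.eventually le_rfl (by fun_prop) hs
  · have : G (bounce m i (x' + τ • v), bounce m i v) = (x', v) := by
      simp only [G, bounce_sub, bounce_smul, bounce_bounce hmi]
      simp
    rw [mem_preimage, this]
    exact ⟨hx', hvi⟩
  · rintro s ⟨h1, h2, h3⟩
    exact ⟨⟨h1, i, hi, τ, hτ, hUP _ h2⟩, G s, h2, h3, (bounce_bounce hmi).symm⟩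

theorem exists_past_of_sorts {n : ℕ} {b : ℝ} {k φ : ℕ} {m : ℕ → ℝ} (hm : ∀ k, 0 < m k)
    {U : Set ((ℕ → ℝ) × (ℕ → ℝ))} (hU : IsOpen U) (hne : U.Nonempty)
    (hUP : ∀ s ∈ U, Past n b k m s.1 s.2) (hs : ∀ s ∈ U, Sorts n m φ s.2) :
    ∃ x v, Past n b (k + φ) m x v ∧ Ascending n v := by
  induction φ generalizing k U with
  | zero =>
    obtain ⟨s, hsU⟩ := hne
    exact ⟨s.1, s.2, hUP s hsU, hs s hsU⟩
  | succ φ ih =>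
    obtain ⟨s₀, hs₀⟩ := hne
    obtain ⟨i, hi, U', hU', hne', hP⟩ := exists_isOpen_past_succ hm hU hUP hs₀ (hs s₀ hs₀).1
    rw [show k + (φ + 1) = k + 1 + φ by ring]
    refine ih hU' hne' (fun s' h => (hP s' h).1) fun s' h => ?_
    obtain ⟨-, s, hsU, hlt, he⟩ := hP s' h
    rw [he]
    exact (hs s hsU).2 i hi hlt

theorem Sorts.smul {n φ : ℕ} {m v : ℕ → ℝ} {c : ℝ} (hc : 0 < c) (h : Sorts n m φ v) :
    Sorts n m φ (c • v) := by
  have hlt : ∀ i j, (c • v) i < (c • v) j ↔ v i < v j := fun i j =>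
    mul_lt_mul_iff_right₀ hc
  induction φ generalizing v with
  | zero => exact fun i hi => (hlt _ _).2 (h i hi)
  | succ φ ih =>
    refine ⟨h.1.imp fun i hi => ⟨hi.1, (hlt _ _).2 hi.2⟩, fun i hi hv => ?_⟩
    rw [bounce_smul]
    exact ih (h.2 i hi ((hlt _ _).1 hv)) fun i j => mul_lt_mul_iff_right₀ hc

theorem Sorts.congr {n φ : ℕ} {m m' v v' : ℕ → ℝ} (h : Sorts n m φ v) (hm : ∀ i < n, m i = m' i)
    (hv : ∀ i < n, v i = v' i) : Sorts n m' φ v' := by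
  induction φ generalizing v v' with
  | zero =>
    intro i hi
    rw [← hv i (by omega), ← hv _ hi]; exact h i hi
  | succ φ ih =>
    refine ⟨h.1.imp fun i hi => ⟨hi.1, ?_⟩, fun i hi hlt => ?_⟩
    · rw [← hv i (by omega), ← hv _ hi.1]; exact hi.2
    · rw [← hv i (by omega), ← hv _ hi] at hlt
      exact ih (h.2 i hi hlt) (bounce_congr hi hm hv)

theorem Ascending.eventually_update {n : ℕ} {y : ℕ → ℝ} (h : Ascending n y) :
    ∀ᶠ X in atTop, Ascending (n + 1) (Function.update y n X) := by
  filter_upwards [eventually_gt_atTop (y (n - 1))] with X hX i hi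
  rw [Function.update_of_ne (by omega)]
  rcases Nat.lt_or_ge (i + 1) n with h1 | h1
  · rw [Function.update_of_ne (by omega)]
    exact h i h1
  · obtain rfl : n = i + 1 := by omega
    rw [Function.update_self]
    exact hX

/-- A slow particle far to the right does not take part in the collisions. -/
theorem Past.add_particle {n : ℕ} {b b' u : ℝ} {k : ℕ} {m x v : ℕ → ℝ} (h : Past n b k m x v)
    (hu : u ≤ b) (hb' : b' < u) : ∀ᶠ X in atTop,
      Past (n + 1) b' k m (Function.update x n X) (Function.update v n u) := by
  have asc := h.ascending.eventually_update
  induction k generalizing x v with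
  | zero =>
    obtain ⟨-, h2, h3⟩ := h
    filter_upwards [asc] with X hX
    refine ⟨hX, fun i hi => ?_, fun i hi => ?_⟩
    · rw [Function.update_of_ne (show i ≠ n by omega)]
      rcases Nat.lt_or_ge (i + 1) n with h1 | h1
      · rw [Function.update_of_ne (by omega)]
        exact h2 i h1
      · obtain rfl : n = i + 1 := by omega
        rw [Function.update_self]
        exact hu.trans_lt (h3 i (by omega))
    · rcases Nat.lt_or_ge i n with h1 | h1
      · rw [Function.update_of_ne (by omega)]
        exact hb'.trans_le (hu.trans (h3 i h1).le)
      · obtain rfl : n = i := by omega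
        rwa [Function.update_self]
  | succ k ih =>
    obtain ⟨-, i, hi, τ, hτ, hp⟩ := h
    have hupd : ∀ (y : ℕ → ℝ) (c : ℝ), bounce m i (Function.update y n c) =
        Function.update (bounce m i y) n c := by
      intro y c
      have e1 : Function.update y n c i = y i := Function.update_of_ne (by omega) _ _
      have e2 : Function.update y n c (i + 1) = y (i + 1) := Function.update_of_ne (by omega) _ _
      funext j
      by_cases hj : j = n
      · subst hj
        rw [bounce_of_ne (by omega) (by omega), Function.update_self, Function.update_self]
      · rw [Function.update_of_ne hj]
        simp only [bounce, e1, e2, Function.update_of_ne hj]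
    -- Undoing the step takes the extra particle from `X` back to `X - τ * u`, which still tends to
    -- infinity.
    have hshift : Tendsto (fun X : ℝ => X - τ * u) atTop atTop :=
      tendsto_atTop_add_const_right _ _ tendsto_id
    filter_upwards [asc, hshift.eventually (ih hp hp.ascending.eventually_update)] with X h1 h2
    refine ⟨h1, i, by omega, τ, hτ, ?_⟩
    rw [hupd]
    convert h2 using 1
    rw [← hupd]
    congr 1
    funext j
    by_cases hj : j = n
    · subst hj; simp
    · simp [Function.update_of_ne hj]

/-! ### Inversions and equal masses. -/

/-- The number of inversions of the terms `u a, …, u (b - 1)`. -/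
noncomputable def inversions (a b : ℕ) (u : ℕ → ℝ) : ℕ :=
  open Classical in
  ((Finset.Ico a b ×ˢ Finset.Ico a b).filter fun p => p.1 < p.2 ∧ u p.2 < u p.1).card

theorem inversions_congr {a b : ℕ} {u u' : ℕ → ℝ} (h : ∀ i, a ≤ i → i < b → u i = u' i) :
    inversions a b u = inversions a b u' := by
  unfold inversions
  congr 1
  refine Finset.filter_congr fun p hp => ?_
  simp only [Finset.mem_product, Finset.mem_Ico] at hp
  rw [h p.1 hp.1.1 hp.1.2, h p.2 hp.2.1 hp.2.2]

theorem inversions_of_lt_left {a b : ℕ} {u : ℕ → ℝ} (h : ∀ i, a < i → i < b → u i < u a) :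
    inversions a b u = inversions (a + 1) b u + (b - (a + 1)) := by
  classical
  have hset : ((Finset.Ico a b ×ˢ Finset.Ico a b).filter fun p => p.1 < p.2 ∧ u p.2 < u p.1) =
      ((Finset.Ico (a + 1) b ×ˢ Finset.Ico (a + 1) b).filter fun p => p.1 < p.2 ∧ u p.2 < u p.1) ∪
        (Finset.Ico (a + 1) b).image fun i => (a, i) := by
    ext ⟨c, d⟩
    simp only [Finset.mem_filter, Finset.mem_product, Finset.mem_Ico, Finset.mem_union,
      Finset.mem_image, Prod.mk.injEq]
    constructor
    · rintro ⟨⟨⟨h1, h2⟩, h3, h4⟩, h5, h6⟩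
      rcases h1.eq_or_lt with rfl | h7
      · exact Or.inr ⟨d, ⟨h5, h4⟩, rfl, rfl⟩
      · exact Or.inl ⟨⟨⟨h7, h2⟩, by omega, h4⟩, h5, h6⟩
    · rintro (⟨⟨⟨h1, h2⟩, h3, h4⟩, h5, h6⟩ | ⟨i, ⟨h1, h2⟩, rfl, rfl⟩)
      · exact ⟨⟨⟨by omega, h2⟩, by omega, h4⟩, h5, h6⟩
      · exact ⟨⟨⟨le_rfl, by omega⟩, by omega, h2⟩, h1, h i h1 h2⟩
  unfold inversions
  rw [hset, Finset.card_union_of_disjoint, Finset.card_image_of_injective, Nat.card_Ico]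
  · exact fun i j hij => (Prod.mk.inj hij).2
  · rw [Finset.disjoint_left]
    rintro ⟨c, d⟩ h1 h2
    simp only [Finset.mem_filter, Finset.mem_product, Finset.mem_Ico, Finset.mem_image,
      Prod.mk.injEq] at h1 h2
    obtain ⟨i, -, rfl, rfl⟩ := h2
    omega

/-- Apart from the pair itself, the transposition maps inversions bijectively to inversions. -/
theorem inversions_swap {a b i : ℕ} {u : ℕ → ℝ} (ha : a ≤ i) (hb : i + 1 < b)
    (h : u (i + 1) < u i) :
    inversions a b u = inversions a b (fun k => u (Equiv.swap i (i + 1) k)) + 1 := by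
  classical
  have hσ := fun k => Equiv.swap_apply_def i (i + 1) k
  set σ := Equiv.swap i (i + 1)
  have hmem : (i, i + 1) ∈
      (Finset.Ico a b ×ˢ Finset.Ico a b).filter fun p => p.1 < p.2 ∧ u p.2 < u p.1 := by
    simp only [Finset.mem_filter, Finset.mem_product, Finset.mem_Ico]
    exact ⟨⟨⟨ha, by omega⟩, by omega, hb⟩, by omega, h⟩
  have hσσ : ∀ k, σ (σ k) = k := Equiv.swap_apply_self _ _
  unfold inversions
  rw [← Finset.card_erase_add_one hmem]
  congr 1
  refine Finset.card_nbij' (fun p => (σ p.1, σ p.2)) (fun p => (σ p.1, σ p.2)) ?_ ?_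
    (fun p _ => by simp [hσσ]) (fun p _ => by simp [hσσ])
  · rintro ⟨c, d⟩ hp
    simp only [Finset.mem_coe, Finset.mem_erase, Finset.mem_filter, Finset.mem_product,
      Finset.mem_Ico, ne_eq, Prod.mk.injEq, hσσ] at hp ⊢
    have hc := hσ c
    have hd := hσ d
    obtain ⟨h1, h2, h3, h4⟩ := hp
    refine ⟨?_, ?_, h4⟩ <;> split_ifs at hc hd <;> omega
  · rintro ⟨c, d⟩ hp
    simp only [Finset.mem_coe, Finset.mem_erase, Finset.mem_filter, Finset.mem_product,
      Finset.mem_Ico, ne_eq, Prod.mk.injEq] at hp ⊢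
    have hc := hσ c
    have hd := hσ d
    obtain ⟨h2, h3, h4⟩ := hp
    have h5 : ¬ (c = i ∧ d = i + 1) := by
      rintro ⟨rfl, rfl⟩
      rw [if_pos rfl] at hc
      rw [if_neg (by omega), if_pos rfl] at hd
      rw [hc, hd] at h4
      exact lt_asymm h h4
    refine ⟨?_, ?_, ?_, h4⟩ <;> split_ifs at hc hd <;> omega

theorem exists_descent_of_inversions_ne_zero {a b : ℕ} {u : ℕ → ℝ} (h : inversions a b u ≠ 0) :
    ∃ i, a ≤ i ∧ i + 1 < b ∧ u (i + 1) < u i := by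
  by_contra! hcon
  have hle : ∀ c d, a ≤ c → c ≤ d → d < b → u c ≤ u d := by
    intro c d hc hcd
    induction d, hcd using Nat.le_induction with
    | base => intro _; exact le_rfl
    | succ d hcd ih => exact fun hd => (ih (by omega)).trans (hcon d (by omega) hd)
  refine h (Finset.card_eq_zero.2 (Finset.filter_eq_empty_iff.2 ?_))
  rintro ⟨c, d⟩ hp ⟨h1, h2⟩
  simp only [Finset.mem_product, Finset.mem_Ico] at hp
  exact absurd (hle c d hp.1.1 h1.le hp.2.2) (not_le.2 h2)

theorem le_of_inversions_eq_zero {a b : ℕ} {u : ℕ → ℝ} (h : inversions a b u = 0) {i : ℕ}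
    (hi : a ≤ i) (hb : i + 1 < b) : u i ≤ u (i + 1) := by
  by_contra! hcon
  have := inversions_swap hi hb hcon
  omega

theorem bounce_of_equal_masses {m u : ℕ → ℝ} {i : ℕ} (h : m i = m (i + 1)) (h0 : m (i + 1) ≠ 0) :
    bounce m i u = fun k => u (Equiv.swap i (i + 1) k) := by
  have hc : 2 * m (i + 1) / (m (i + 1) + m (i + 1)) = 1 := by field_simp; ring
  funext k
  rw [Equiv.swap_apply_def]
  simp only [bounce, h, hc]
  split_ifs <;> ring

theorem injOn_swap {a b i : ℕ} {u : ℕ → ℝ} (ha : a ≤ i) (hb : i + 1 < b)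
    (h : InjOn u (Ico a b)) : InjOn (fun k => u (Equiv.swap i (i + 1) k)) (Ico a b) := by
  refine h.comp (Equiv.injective _).injOn fun k hk => ?_
  have := Equiv.swap_apply_def i (i + 1) k
  rw [mem_Ico] at hk ⊢
  split_ifs at this <;> omega

/-- A collision of equal masses exchanges the velocities and so removes one inversion, whichever
approaching pair is chosen. Distinctness turns the final weak order into a strict one. -/
theorem sorts_of_equal_masses {n φ : ℕ} {u : ℕ → ℝ} (hu : InjOn u (Ico 0 n))
    (h : inversions 0 n u = φ) : Sorts n (fun _ => 1) φ u := by
  induction φ generalizing u with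
  | zero =>
    intro i hi
    refine lt_of_le_of_ne (le_of_inversions_eq_zero h (Nat.zero_le i) hi) fun he => ?_
    have := hu (by simp; omega) (by simp; omega) he
    omega
  | succ φ ih =>
    constructor
    · obtain ⟨i, -, hi⟩ := exists_descent_of_inversions_ne_zero (a := 0) (b := n) (u := u)
        (by omega)
      exact ⟨i, hi⟩
    · intro i hi hlt
      rw [bounce_of_equal_masses rfl one_ne_zero]
      refine ih (injOn_swap (Nat.zero_le i) hi hu) ?_
      have := inversions_swap (Nat.zero_le i) hi hlt
      omega

theorem inversions_of_descending {n k : ℕ} {u : ℕ → ℝ} (hk : k ≤ n)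
    (h : ∀ i j, i < j → j < n → u j < u i) : inversions (n - k) n u = k.choose 2 := by
  induction k with
  | zero =>
    simp [inversions]
  | succ k ih =>
    have e : (k + 1).choose 2 = k + k.choose 2 := by
      rw [Nat.choose_succ_succ' k 1, Nat.choose_one_right]
    rw [inversions_of_lt_left fun i h1 h2 => h _ i h1 h2, show n - (k + 1) + 1 = n - k by omega,
      ih (by omega), e]
    omega

/-- For equal masses all pairs of particles with decreasing velocities collide exactly once. -/
theorem exists_past_choose_two (n : ℕ) :
    ∃ x v, Past n (-n : ℝ) (n.choose 2) (fun _ => 1) x v ∧ Ascending n v := by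
  have hanti : ∀ v : ℕ → ℝ, (∀ i, i + 1 < n → v (i + 1) < v i) → ∀ i j, i < j → j < n →
      v j < v i := fun v hv i j hij hj =>
    neg_lt_neg_iff.1 (Ascending.lt (y := -v) (fun i hi => neg_lt_neg (hv i hi)) hij hj)
  let U : Set ((ℕ → ℝ) × (ℕ → ℝ)) := {s | Past n (-n : ℝ) 0 (fun _ => 1) s.1 s.2}
  have hU : IsOpen U := Past.isOpen fun _ => one_pos
  have hne : U.Nonempty := by
    refine ⟨(fun i => i, fun i => -i), fun i _ => by simp, fun i _ => by simp, fun i hi => ?_⟩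
    simpa using hi
  have := exists_past_of_sorts (φ := n.choose 2) (fun _ => one_pos) hU hne (fun s hs => hs)
    fun s hs => ?_
  · simpa using this
  have hv := hanti s.2 hs.2.1
  refine sorts_of_equal_masses (fun i hi j hj he => ?_) ?_
  · rcases lt_trichotomy i j with h | h | h
    · exact absurd he (hv i j h hj.2).ne'
    · exact h
    · exact absurd he (hv j i h hi.2).ne
  · have := inversions_of_descending le_rfl hv
    rwa [Nat.sub_self] at this

/-! ### The minimal number: one collision for each neighbouring pair. -/

/-- A fast particle which hits the others, and only once each, with masses increasing so slowly
that the particles which have been hit first are the slowest afterwards. -/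
theorem exists_past_pred {ε : ℝ} (hε : 0 < ε) (n : ℕ) :
    ∃ (m : ℕ → ℝ) (b : ℝ) (x v : ℕ → ℝ), (∀ k, 0 < m k ∧ |m k - 1| < ε) ∧
      Past (n + 1) b n m x v ∧ (∀ i < n, v i < b) ∧ b < v n ∧ Ascending (n + 1) v := by
  induction n with
  | zero =>
    refine ⟨fun _ => 1, 0, 0, fun _ => 1, fun k => ⟨one_pos, by simpa using hε⟩,
      ⟨fun i hi => by omega, fun i hi => by omega, fun i hi => one_pos⟩,
      fun i hi => by omega, one_pos, fun i hi => by omega⟩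
  | succ n ih =>
    obtain ⟨m, b, x, v, hm, hP, hvb, hbv, hv⟩ := ih
    have hmn := (hm n).1
    have ev1 : ∀ᶠ δ in 𝓝[>] (0 : ℝ), |m n + δ - 1| < ε :=
      nhdsWithin_le_nhds (ContinuousAt.eventually_lt (by fun_prop) (by fun_prop)
        (by simpa using (hm n).2))
    -- At `δ = 0` the striker would take over exactly the velocity `b` of its target, which exceeds
    -- all `v i` with `i < n`.
    have ev2 : ∀ᶠ δ in 𝓝[>] (0 : ℝ), ∀ i ∈ Finset.range n,
        v i < v n - 2 * (m n + δ) / (m n + (m n + δ)) * (v n - b) := by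
      rw [Finset.eventually_all]
      intro i hi
      have hne : m n + (m n + 0) ≠ 0 := by positivity
      refine nhdsWithin_le_nhds (ContinuousAt.eventually_lt (by fun_prop)
        (by fun_prop (disch := assumption)) ?_)
      have : 2 * (m n + 0) / (m n + (m n + 0)) = 1 := by field_simp; ring
      rw [this]
      linarith [hvb i (by simpa using hi)]
    obtain ⟨δ, hδ, hδε, hδv⟩ := (eventually_mem_nhdsWithin.and (ev1.and ev2)).exists
    have hδ : 0 < δ := hδ
    set m' := Function.update m (n + 1) (m n + δ) with hm'
    have hm1 : m' (n + 1) = m n + δ := Function.update_self _ _ _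
    have hm2 : ∀ k, k ≠ n + 1 → m' k = m k := fun k hk => Function.update_of_ne hk _ _
    have hmpos : ∀ k, 0 < m' k ∧ |m' k - 1| < ε := fun k => by
      by_cases hk : k = n + 1
      · rw [hk, hm1]; exact ⟨by positivity, hδε⟩
      · rw [hm2 k hk]; exact hm k
    set v' := Function.update v (n + 1) b with hv'
    have hv1 : v' (n + 1) = b := Function.update_self _ _ _
    have hv2 : ∀ k, k ≠ n + 1 → v' k = v k := fun k hk => Function.update_of_ne hk _ _
    have hw : bounce m' n v' n = v n - 2 * (m n + δ) / (m n + (m n + δ)) * (v n - b) := by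
      rw [bounce_left, hm1, hm2 n (by omega), hv1, hv2 n (by omega)]
    -- The target is strictly heavier, so the striker loses more than the velocity difference. This
    -- leaves room for the new separating bound `b'`, which is also below all initial velocities.
    have hwb : bounce m' n v' n < b := by
      have : 1 < 2 * (m n + δ) / (m n + (m n + δ)) := by
        rw [one_lt_div (by positivity)]; linarith
      rw [hw]
      nlinarith
    have hw' : b < bounce m' n v' (n + 1) := by
      rw [bounce_right, hm1, hm2 n (by omega), hv1, hv2 n (by omega)]
      refine lt_add_of_pos_right _ (mul_pos (by positivity) (sub_pos.2 hbv))
    obtain ⟨b', hb1, hb2⟩ := exists_between hwb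
    have hP' : Past (n + 1) b n m' x v :=
      hP.congr (fun i hi => (hm2 i (by omega)).symm) (fun _ _ => rfl) fun _ _ => rfl
    obtain ⟨X, hX⟩ := (hP'.add_particle le_rfl hb2).exists
    have hpos : ∀ k, 0 < m' k := fun k => (hmpos k).1
    set s₀ : (ℕ → ℝ) × (ℕ → ℝ) := (Function.update x (n + 1) X, v')
    have cont : ∀ k, Continuous fun s : (ℕ → ℝ) × (ℕ → ℝ) => bounce m' n s.2 k := fun k =>
      continuous_pi_iff.1 (continuous_bounce.comp continuous_snd) k
    have e1 : ∀ᶠ s : (ℕ → ℝ) × (ℕ → ℝ) in 𝓝 s₀, Past (n + 1 + 1) b' n m' s.1 s.2 :=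
      (Past.isOpen hpos).mem_nhds hX
    have e2 : ∀ᶠ s : (ℕ → ℝ) × (ℕ → ℝ) in 𝓝 s₀, Ascending (n + 1) s.2 :=
      Ascending.eventually le_rfl (by fun_prop) fun i hi => by
        change v' i < v' (i + 1)
        rw [hv2 i (by omega), hv2 (i + 1) (by omega)]; exact hv i hi
    have e3 : ∀ᶠ s : (ℕ → ℝ) × (ℕ → ℝ) in 𝓝 s₀, ∀ i ∈ Finset.range n,
        s.2 i < bounce m' n s.2 n := by
      rw [Finset.eventually_all]
      intro i hi
      refine ContinuousAt.eventually_lt (by fun_prop) (cont n).continuousAt ?_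
      have := hδv i hi
      rw [← hw, ← hv2 i (by have := Finset.mem_range.1 hi; omega)] at this
      exact this
    have e4 : ∀ᶠ s : (ℕ → ℝ) × (ℕ → ℝ) in 𝓝 s₀, bounce m' n s.2 n < b' :=
      ContinuousAt.eventually_lt (cont n).continuousAt (by fun_prop) hb1
    have e5 : ∀ᶠ s : (ℕ → ℝ) × (ℕ → ℝ) in 𝓝 s₀, b' < bounce m' n s.2 (n + 1) :=
      ContinuousAt.eventually_lt (by fun_prop) (cont (n + 1)).continuousAt (hb2.trans hw')
    obtain ⟨U, hUc, hU, hs₀⟩ := eventually_nhds_iff.1 (e1.and (e2.and (e3.and (e4.and e5))))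
    obtain ⟨i, hi, U', -, ⟨s', hs'⟩, hstep⟩ := exists_isOpen_past_succ hpos hU
      (fun s hs => (hUc s hs).1) hs₀ ⟨n, by omega, by
        change v' (n + 1) < v' n
        rw [hv1, hv2 n (by omega)]; exact hbv⟩
    obtain ⟨hP1, s, hsU, hlt, he⟩ := hstep s' hs'
    obtain ⟨-, h2, h3, h4, h5⟩ := hUc s hsU
    -- The velocities of the first `n + 1` particles increase, so only the last pair can be
    -- approaching.
    have hin : i = n := by
      by_contra hne
      exact lt_asymm hlt (h2 i (by omega))
    subst hin
    have hs'i : ∀ k < i, s'.2 k = s.2 k := fun k hk => by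
      rw [he, bounce_of_ne (by omega) (by omega)]
    have hs'lt : ∀ k < i, s'.2 k < s'.2 i := fun k hk => by
      rw [hs'i k hk, he]; exact h3 k (by simpa using hk)
    have h4' : s'.2 i < b' := by rw [he]; exact h4
    have h5' : b' < s'.2 (i + 1) := by rw [he]; exact h5
    refine ⟨m', b', s'.1, s'.2, hmpos, hP1, fun k hk => ?_, h5', fun k hk => ?_⟩
    · rcases Nat.lt_succ_iff_lt_or_eq.1 hk with h | rfl
      · exact (hs'lt k h).trans h4'
      · exact h4'
    · rcases Nat.lt_trichotomy (k + 1) i with h | h | h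
      · rw [hs'i k (by omega), hs'i _ h]; exact h2 k (by omega)
      · rw [h]; exact hs'lt k (by omega)
      · obtain rfl : k = i := by omega
        exact h4'.trans h5'

/-! ### Convex masses and the number $\binom{n+1}3$. -/

/-- Masses which are convex in the index. -/
def convexMass (δ : ℝ) : ℕ → ℝ := fun k => 1 + δ * (k : ℝ) ^ 2

/-- The particle `j` among `0, …, n` is much faster than the others and moves to the left with
velocity `V / δ`, the particles to its left have the velocities `s`, and those to its right have
the velocities `u`. Up to collisions between particles to the left of `j`, every sequence of
collisions of neighbours which approach each other sorts the velocities in exactly `φ` steps. -/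
def Crossing (n : ℕ) : ℕ → ℕ → ℝ → ℝ → (ℕ → ℝ) → (ℕ → ℝ) → Prop
  | 0, j, δ, V, _, u => j = 0 ∧ (0 < n → V < δ * u 1) ∧ ∀ i, 0 < i → i + 1 < n + 1 → u i < u (i + 1)
  | φ + 1, j, δ, V, s, u =>
      (0 < j ∨ ∃ i, j < i ∧ i + 1 < n + 1 ∧ u (i + 1) < u i) ∧
      (j < n → V < δ * u (j + 1)) ∧
      (∀ i, j < i → i + 1 < n + 1 → u i < u (i + 1) ∨
        (u (i + 1) < u i ∧ Crossing n φ j δ V s (bounce (convexMass δ) i u))) ∧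
      ∀ l, j = l + 1 → V < δ * s l ∧ Crossing n φ l δ
        (δ * s l - 2 * convexMass δ (l + 1) / (convexMass δ l + convexMass δ (l + 1)) *
          (δ * s l - V)) s
        (Function.update u j
          (V * (2 * l + 1) / (convexMass δ l + convexMass δ (l + 1)) +
            2 * convexMass δ l / (convexMass δ l + convexMass δ (l + 1)) * s l))

theorem convexMass_pos {δ : ℝ} (hδ : 0 ≤ δ) (k : ℕ) : 0 < convexMass δ k := by
  unfold convexMass; positivity

theorem continuous_convexMass : Continuous convexMass := by
  refine continuous_pi fun k => ?_
  simp only [convexMass]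
  fun_prop

/-- All conditions are strict and continuous in the data, also at `δ = 0`: this is why the fast
velocity is stored as `V` and not as `V / δ`. -/
theorem Crossing.eventually {n φ j : ℕ} {δ V : ℝ} {s u : ℕ → ℝ} (hδ : 0 ≤ δ)
    (h : Crossing n φ j δ V s u) :
    ∀ᶠ p : ℝ × ℝ × (ℕ → ℝ) × (ℕ → ℝ) in 𝓝 (δ, V, s, u),
      Crossing n φ j p.1 p.2.1 p.2.2.1 p.2.2.2 := by
  have hfast : (j < n → V < δ * u (j + 1)) → ∀ᶠ p : ℝ × ℝ × (ℕ → ℝ) × (ℕ → ℝ) in 𝓝 (δ, V, s, u),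
      j < n → p.2.1 < p.1 * p.2.2.2 (j + 1) := fun h => by
    rw [eventually_imp_distrib_left]
    exact fun hj => ContinuousAt.eventually_lt (by fun_prop) (by fun_prop) (h hj)
  induction φ generalizing j V u with
  | zero =>
    obtain ⟨rfl, h1, h2⟩ := h
    have e2 : ∀ᶠ p : ℝ × ℝ × (ℕ → ℝ) × (ℕ → ℝ) in 𝓝 (δ, V, s, u), ∀ i ∈ Finset.range n,
        0 < i → p.2.2.2 i < p.2.2.2 (i + 1) := by
      rw [Finset.eventually_all]
      intro i hi
      rw [eventually_imp_distrib_left]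
      exact fun hi0 => ContinuousAt.eventually_lt (by fun_prop) (by fun_prop)
        (h2 i hi0 (by simpa using hi))
    filter_upwards [hfast h1, e2] with p h1 h2
    exact ⟨rfl, h1, fun i hi hin => h2 i (by simpa using hin) hi⟩
  | succ φ ih =>
    obtain ⟨h0, h1, h2, h3⟩ := h
    have e0 : ∀ᶠ p : ℝ × ℝ × (ℕ → ℝ) × (ℕ → ℝ) in 𝓝 (δ, V, s, u),
        0 < j ∨ ∃ i, j < i ∧ i + 1 < n + 1 ∧ p.2.2.2 (i + 1) < p.2.2.2 i := by
      rcases h0 with h0 | ⟨i, hi, hin, hlt⟩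
      · exact Eventually.of_forall fun _ => Or.inl h0
      · have : ∀ᶠ p : ℝ × ℝ × (ℕ → ℝ) × (ℕ → ℝ) in 𝓝 (δ, V, s, u),
            p.2.2.2 (i + 1) < p.2.2.2 i :=
          ContinuousAt.eventually_lt (by fun_prop) (by fun_prop) hlt
        exact this.mono fun p hp => Or.inr ⟨i, hi, hin, hp⟩
    have e2 : ∀ᶠ p : ℝ × ℝ × (ℕ → ℝ) × (ℕ → ℝ) in 𝓝 (δ, V, s, u), ∀ i ∈ Finset.range n,
        j < i → p.2.2.2 i < p.2.2.2 (i + 1) ∨ (p.2.2.2 (i + 1) < p.2.2.2 i ∧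
          Crossing n φ j p.1 p.2.1 p.2.2.1 (bounce (convexMass p.1) i p.2.2.2)) := by
      rw [Finset.eventually_all]
      intro i hi
      rw [eventually_imp_distrib_left]
      intro hij
      rcases h2 i hij (by simpa using hi) with hlt | ⟨hlt, hc⟩
      · have : ∀ᶠ p : ℝ × ℝ × (ℕ → ℝ) × (ℕ → ℝ) in 𝓝 (δ, V, s, u),
            p.2.2.2 i < p.2.2.2 (i + 1) :=
          ContinuousAt.eventually_lt (by fun_prop) (by fun_prop) hlt
        exact this.mono fun p hp => Or.inl hp
      · have e : ∀ᶠ p : ℝ × ℝ × (ℕ → ℝ) × (ℕ → ℝ) in 𝓝 (δ, V, s, u),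
            p.2.2.2 (i + 1) < p.2.2.2 i :=
          ContinuousAt.eventually_lt (by fun_prop) (by fun_prop) hlt
        have hcont : ContinuousAt (fun p : ℝ × ℝ × (ℕ → ℝ) × (ℕ → ℝ) =>
            (p.1, p.2.1, p.2.2.1, bounce (convexMass p.1) i p.2.2.2)) (δ, V, s, u) := by
          have hb : ContinuousAt (fun p : ℝ × ℝ × (ℕ → ℝ) × (ℕ → ℝ) =>
              bounce (convexMass p.1) i p.2.2.2) (δ, V, s, u) :=
            ContinuousAt.comp (f := fun p : ℝ × ℝ × (ℕ → ℝ) × (ℕ → ℝ) =>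
              (convexMass p.1, p.2.2.2))
              (continuousAt_bounce (add_pos (convexMass_pos hδ _) (convexMass_pos hδ _)).ne')
              (by have := continuous_convexMass; fun_prop)
          fun_prop
        filter_upwards [e, hcont.eventually (ih hc fun hh => by
          rw [eventually_imp_distrib_left]
          exact fun hj => ContinuousAt.eventually_lt (by fun_prop) (by fun_prop) (hh hj))]
          with p hp hp'
        exact Or.inr ⟨hp, hp'⟩
    have e3 : ∀ᶠ p : ℝ × ℝ × (ℕ → ℝ) × (ℕ → ℝ) in 𝓝 (δ, V, s, u), ∀ l, j = l + 1 →
        p.2.1 < p.1 * p.2.2.1 l ∧ Crossing n φ l p.1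
          (p.1 * p.2.2.1 l - 2 * convexMass p.1 (l + 1) /
            (convexMass p.1 l + convexMass p.1 (l + 1)) * (p.1 * p.2.2.1 l - p.2.1)) p.2.2.1
          (Function.update p.2.2.2 j
            (p.2.1 * (2 * l + 1) / (convexMass p.1 l + convexMass p.1 (l + 1)) +
              2 * convexMass p.1 l / (convexMass p.1 l + convexMass p.1 (l + 1)) *
                p.2.2.1 l)) := by
      rcases j with - | l
      · exact Eventually.of_forall fun p l hl => by omega
      obtain ⟨hlt, hc⟩ := h3 l rfl
      have hmass : convexMass δ l + convexMass δ (l + 1) ≠ 0 :=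
        (add_pos (convexMass_pos hδ _) (convexMass_pos hδ _)).ne'
      have hcm : ∀ k, Continuous fun δ => convexMass δ k := continuous_pi_iff.1 continuous_convexMass
      have e : ∀ᶠ p : ℝ × ℝ × (ℕ → ℝ) × (ℕ → ℝ) in 𝓝 (δ, V, s, u), p.2.1 < p.1 * p.2.2.1 l :=
        ContinuousAt.eventually_lt (by fun_prop) (by fun_prop) hlt
      have hcont : ContinuousAt (fun p : ℝ × ℝ × (ℕ → ℝ) × (ℕ → ℝ) =>
          (p.1, p.1 * p.2.2.1 l - 2 * convexMass p.1 (l + 1) /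
            (convexMass p.1 l + convexMass p.1 (l + 1)) * (p.1 * p.2.2.1 l - p.2.1), p.2.2.1,
          Function.update p.2.2.2 (l + 1)
            (p.2.1 * (2 * l + 1) / (convexMass p.1 l + convexMass p.1 (l + 1)) +
              2 * convexMass p.1 l / (convexMass p.1 l + convexMass p.1 (l + 1)) *
                p.2.2.1 l))) (δ, V, s, u) := by
        have h0 := hcm l
        have h1 := hcm (l + 1)
        refine ContinuousAt.prodMk (by fun_prop) (ContinuousAt.prodMk
          (by fun_prop (disch := assumption)) (ContinuousAt.prodMk (by fun_prop)
            (ContinuousAt.update (by fun_prop) _ (by fun_prop (disch := assumption)))))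
      filter_upwards [e, hcont.eventually (ih hc fun hh => by
        rw [eventually_imp_distrib_left]
        exact fun hj => ContinuousAt.eventually_lt (by fun_prop) (by fun_prop) (hh hj))]
        with p hp hp' l' hl'
      obtain rfl : l = l' := by omega
      exact ⟨hp, hp'⟩
    filter_upwards [e0, hfast h1, e2, e3] with p h0 h1 h2 h3
    exact ⟨h0, h1, fun i hij hi => h2 i (by simpa using hi) hij, h3⟩

/-- The velocity `A` at `j`, preceded by terms of `s` and followed by terms of `u`. -/
def joinAt (j : ℕ) (A : ℝ) (s u : ℕ → ℝ) : ℕ → ℝ := fun k =>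
  if k < j then s k else if k = j then A else u k

/-- Particles left of `j` are in increasing order and have not been touched, and `j` outruns
everything to its right. So only `j` with its left neighbour, or pairs to the right of `j`, can
collide, and these are the cases listed in `Crossing`. -/
theorem Crossing.sorts {n φ j : ℕ} {δ V : ℝ} {s u : ℕ → ℝ} (hδ : 0 < δ)
    (h : Crossing n φ j δ V s u) (hj : j ≤ n) (hs : Ascending j s) :
    Sorts (n + 1) (convexMass δ) φ (joinAt j (V / δ) s u) := by
  have hfast : ∀ {V c : ℝ}, V < δ * c ↔ V / δ < c := fun {V c} => by
    rw [div_lt_iff₀ hδ, mul_comm]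
  induction φ generalizing j V u with
  | zero =>
    obtain ⟨rfl, h1, h2⟩ := h
    intro i hi
    rcases Nat.eq_zero_or_pos i with rfl | hi0
    · simpa [joinAt] using hfast.1 (h1 (by omega))
    · simpa [joinAt, hi0.ne'] using h2 i hi0 hi
  | succ φ ih =>
    obtain ⟨h0, h1, h2, h3⟩ := h
    constructor
    · rcases h0 with h0 | ⟨i, hij, hi, hlt⟩
      · obtain ⟨l, rfl⟩ : ∃ l, j = l + 1 := ⟨j - 1, by omega⟩
        exact ⟨l, by omega, by simpa [joinAt] using hfast.1 (h3 l rfl).1⟩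
      · refine ⟨i, hi, ?_⟩
        simp only [joinAt]
        rw [if_neg (by omega), if_neg (by omega), if_neg (by omega), if_neg (by omega)]
        exact hlt
    · intro i hi hlt
      rcases Nat.lt_trichotomy i j with hij | rfl | hij
      · by_cases hij' : i + 1 = j
        · subst hij'
          obtain ⟨-, hc⟩ := h3 i rfl
          convert ih hc (by omega) (fun k hk => hs k (by omega)) using 1
          have hne : convexMass δ i + convexMass δ (i + 1) ≠ 0 :=
            (add_pos (convexMass_pos hδ.le _) (convexMass_pos hδ.le _)).ne'
          funext k
          rcases Nat.lt_trichotomy k i with hk | rfl | hk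
          · rw [bounce_of_ne (by omega) (by omega)]
            simp [joinAt, hk, show k < i + 1 by omega]
          · rw [bounce_left]
            simp only [joinAt, lt_add_iff_pos_right, Nat.lt_one_iff, pos_of_gt, if_true,
              lt_irrefl, if_false]
            field_simp
          · by_cases hk' : k = i + 1
            · subst hk'
              rw [bounce_right]
              simp only [joinAt, lt_add_iff_pos_right, Nat.lt_one_iff, pos_of_gt, if_true,
                lt_irrefl, if_false, Function.update_self]
              rw [if_neg (by omega), if_neg (by omega)]
              -- The factor `δ` of the mass difference cancels the denominator of the fast velocity
              -- `V / δ`.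
              have hd : convexMass δ (i + 1) = convexMass δ i + δ * (2 * i + 1) := by
                simp only [convexMass]; push_cast; ring
              rw [hd] at hne ⊢
              field_simp
              ring
            · rw [bounce_of_ne (by omega) hk']
              simp only [joinAt]
              rw [if_neg (by omega), if_neg (by omega), if_neg (by omega), if_neg (by omega),
                Function.update_of_ne hk']
        · have := hs i (by omega)
          simp only [joinAt] at hlt
          rw [if_pos (by omega), if_pos (by omega)] at hlt
          exact absurd hlt (lt_asymm this)
      · have hlt : u (i + 1) < V / δ := by simpa [joinAt] using hlt
        exact absurd hlt (lt_asymm (hfast.1 (h1 (by omega))))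
      · have e1 : ∀ w : ℕ → ℝ, ∀ k > j, joinAt j (V / δ) s w k = w k := fun w k hk => by
          simp only [joinAt]
          rw [if_neg (by omega), if_neg (by omega)]
        rw [e1 _ _ (by omega), e1 _ _ hij] at hlt
        rcases h2 i hij hi with h4 | ⟨-, hc⟩
        · exact absurd hlt (lt_asymm h4)
        convert ih hc hj hs using 1
        funext k
        by_cases hk : j < k
        · rw [e1 _ k hk]
          simp only [bounce, e1 _ _ hij, e1 _ (i + 1) (by omega), e1 _ k hk]
        · rw [bounce_of_ne (by omega) (by omega)]
          simp only [joinAt]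
          split_ifs <;> first | rfl | omega

/-- In the limit of equal masses a fast particle leaves the velocities of the others in decreasing
order, and the number of the remaining collisions does not depend on the positions. -/
theorem crossing_zero {n φ j : ℕ} {u : ℕ → ℝ} (hj : j ≤ n)
    (hinj : InjOn u (Ico (j + 1) (n + 1)))
    (hu : ∀ l, j = l + 1 → ∀ i, j < i → i ≤ n → u i < -(2 * l + 1) / 2)
    (hφ : φ = j + inversions (j + 1) (n + 1) u + ∑ i ∈ Finset.range j, (n - 1 - i)) :
    Crossing n φ j 0 (-1) 0 u := by
  have hM : convexMass 0 = fun _ => 1 := by funext k; simp [convexMass]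
  induction φ generalizing j u with
  | zero =>
    obtain rfl : j = 0 := by omega
    refine ⟨rfl, fun _ => by norm_num, fun i hi hin => ?_⟩
    refine lt_of_le_of_ne (le_of_inversions_eq_zero (a := 0 + 1) (b := n + 1) (by omega)
      (by omega) hin) fun he => ?_
    have := hinj ⟨by omega, by omega⟩ ⟨by omega, by omega⟩ he
    omega
  | succ φ ih =>
    refine ⟨?_, fun _ => by norm_num, fun i hij hi => ?_, fun l hl => ⟨by norm_num, ?_⟩⟩
    · rcases Nat.eq_zero_or_pos j with rfl | hj0
      · obtain ⟨i, hi⟩ := exists_descent_of_inversions_ne_zero (a := 0 + 1) (b := n + 1) (u := u)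
          (by rw [Finset.range_zero, Finset.sum_empty] at hφ; omega)
        exact Or.inr ⟨i, by omega, hi.2⟩
      · exact Or.inl hj0
    · have hne : u i ≠ u (i + 1) := fun he => by
        have := hinj ⟨hij, by omega⟩ ⟨by omega, hi⟩ he
        omega
      refine hne.lt_or_gt.imp_right fun hlt => ⟨hlt, ?_⟩
      rw [hM, bounce_of_equal_masses rfl one_ne_zero]
      refine ih hj (injOn_swap hij hi hinj) (fun l hl k hk hkn => ?_) ?_
      · have := Equiv.swap_apply_def i (i + 1) k
        refine hu l hl _ ?_ ?_ <;> split_ifs at this <;> omega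
      · have := inversions_swap (a := j + 1) hij hi hlt
        omega
    · subst hl
      -- The velocity left behind at `l + 1` in the limit; it exceeds all velocities further right.
      have hc : (-1 : ℝ) * (2 * l + 1) / (1 + 1) + 2 * 1 / (1 + 1) * 0 = -(2 * l + 1) / 2 := by
        ring
      simp only [hM, Pi.zero_apply, hc]
      norm_num only
      have hlt : ∀ i, l + 1 < i → i < n + 1 → u i < -(2 * l + 1) / 2 := fun i h1 h2 =>
        hu l rfl i h1 (by omega)
      set c : ℝ := -(2 * l + 1) / 2 with hcdef
      have hup : ∀ i, l + 1 < i → Function.update u (l + 1) c i = u i := fun i hi =>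
        Function.update_of_ne (by omega) _ _
      have hups : Function.update u (l + 1) c (l + 1) = c := Function.update_self _ _ _
      refine ih (by omega) ?_ ?_ ?_
      · intro p hp q hq he
        rcases hp.1.eq_or_lt with h1 | h1 <;> rcases hq.1.eq_or_lt with h2 | h2
        · omega
        · rw [← h1, hups, hup q h2] at he
          exact absurd he (hlt q h2 hq.2).ne'
        · rw [← h2, hups, hup p h1] at he
          exact absurd he (hlt p h1 hp.2).ne
        · rw [hup p h1, hup q h2] at he
          exact hinj ⟨h1, hp.2⟩ ⟨h2, hq.2⟩ he
      · rintro r rfl i hi hin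
        have hcr : c < -(2 * r + 1) / 2 := by rw [hcdef]; push_cast; linarith
        rcases (show r + 1 + 1 ≤ i by omega).eq_or_lt with h1 | h1
        · rw [← h1, hups]; exact hcr
        · rw [hup i h1]; exact (hlt i h1 (by omega)).trans hcr
      -- The particle left behind creates one inversion with each of the `n - 1 - l` particles to
      -- its right, the last summand of `hφ`.
      · rw [inversions_of_lt_left fun i h1 h2 => by rw [hup i h1, hups]; exact hlt i h1 h2,
          inversions_congr fun i h1 _ => hup i (by omega)]
        rw [Finset.sum_range_succ] at hφ
        omega

/-- At the start nothing lies to the right of the fast particle, so the count is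
$n+\sum_{i<n}(n-1-i)=\binom{n+1}2$. The mass parameter `δ` is chosen before `s`, since the masses
stay fixed while the velocity scale may grow with each added particle. -/
theorem eventually_crossing (n : ℕ) : ∀ᶠ δ in 𝓝[>] (0 : ℝ), ∀ᶠ s in 𝓝 (0 : ℕ → ℝ),
    Crossing n ((n + 1).choose 2) n δ (-1) s 0 := by
  have h0 : Crossing n ((n + 1).choose 2) n 0 (-1) 0 0 := by
    refine crossing_zero le_rfl (fun i hi => ?_) (fun l _ i h1 h2 => by omega) ?_
    · have := hi.1; have := hi.2; omega
    · have h1 : inversions (n + 1) (n + 1) 0 = 0 := by simp [inversions]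
      rw [h1, Finset.sum_range_reflect (fun i => i), Finset.sum_range_id, ← Nat.choose_two_right,
        Nat.choose_succ_succ' n 1, Nat.choose_one_right]
      rfl
  have h1 : Tendsto (fun p : ℝ × (ℕ → ℝ) => (p.1, (-1 : ℝ), p.2, (0 : ℕ → ℝ))) (𝓝 (0, 0))
      (𝓝 (0, -1, 0, 0)) := by
    apply Continuous.tendsto'
    · fun_prop
    · rfl
  exact nhdsWithin_le_nhds (h1.eventually (h0.eventually le_rfl)).curry_nhds

/-- Each particle added from the right is so fast that, in its velocity scale, the others are nearly
at rest. It contributes the $\binom{n+1}2$ collisions of a crossing. -/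
theorem exists_past_choose_three {δ : ℝ} (hδ : 0 < δ) {n : ℕ}
    (h : ∀ r ≤ n, ∀ᶠ s in 𝓝 (0 : ℕ → ℝ), Crossing r ((r + 1).choose 2) r δ (-1) s 0) :
    ∃ b x v, Past (n + 1) b ((n + 2).choose 3) (convexMass δ) x v ∧ Ascending (n + 1) v := by
  induction n with
  | zero =>
    exact ⟨-1, 0, 0, ⟨fun i hi => by omega, fun i hi => by omega, fun i hi => by simp⟩,
      fun i hi => by omega⟩
  | succ r ih =>
    obtain ⟨b, x, v, hP, hv⟩ := ih fun r' hr' => h r' (by omega)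
    have hpos := convexMass_pos hδ.le
    set n := r + 1 with hn
    -- With `δ * a` as unit of velocity the new particle has velocity `-1 / δ`, that is `V = -1`,
    -- and the old velocities tend to `0` as `a` grows.
    have hlim : Tendsto (fun a : ℝ => fun i => v i / (δ * a)) atTop (𝓝 (0 : ℕ → ℝ)) :=
      tendsto_pi_nhds.2 fun i => tendsto_const_nhds.div_atTop (tendsto_id.const_mul_atTop hδ)
    have hcr := hlim.eventually (eventually_eventually_nhds.2 (h n le_rfl))
    obtain ⟨a, ha, ha0, hab⟩ :=
      (hcr.and ((eventually_gt_atTop 0).and (eventually_ge_atTop (-b)))).exists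
    obtain ⟨X, hX⟩ :=
      (hP.add_particle (u := -a) (by linarith) (sub_one_lt (-a))).exists
    set v' := Function.update v n (-a) with hv'
    have hv1 : v' n = -a := Function.update_self _ _ _
    have hv2 : ∀ i, i < n → v' i = v i := fun i hi => Function.update_of_ne (by omega) _ _
    set s₀ : (ℕ → ℝ) × (ℕ → ℝ) := (Function.update x n X, v')
    have e1 : ∀ᶠ s : (ℕ → ℝ) × (ℕ → ℝ) in 𝓝 s₀,
        Past (n + 1) (-a - 1) ((r + 2).choose 3) (convexMass δ) s.1 s.2 :=
      (Past.isOpen hpos).mem_nhds hX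
    have e2 : ∀ᶠ s : (ℕ → ℝ) × (ℕ → ℝ) in 𝓝 s₀, Ascending n s.2 :=
      Ascending.eventually le_rfl (by fun_prop) fun i hi => by
        change v' i < v' (i + 1)
        rw [hv2 i (by omega), hv2 (i + 1) hi]; exact hv i (by omega)
    have e3 : ∀ᶠ s : (ℕ → ℝ) × (ℕ → ℝ) in 𝓝 s₀, s.2 n < 0 :=
      ContinuousAt.eventually_lt (by fun_prop) (by fun_prop)
        (show v' n < 0 by rw [hv1]; linarith)
    -- The unit of velocity now varies with the state. The entries from `n` on are padded so that
    -- the rescaled sequence at `s₀` is the one in `ha`.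
    have e4 : ∀ᶠ s : (ℕ → ℝ) × (ℕ → ℝ) in 𝓝 s₀, Crossing n ((n + 1).choose 2) n δ (-1)
        (fun i => if i < n then s.2 i / (δ * -s.2 n) else v i / (δ * a)) 0 := by
      have hc : ContinuousAt (fun s : (ℕ → ℝ) × (ℕ → ℝ) =>
          fun i => if i < n then s.2 i / (δ * -s.2 n) else v i / (δ * a)) s₀ := by
        refine continuousAt_pi.2 fun i => ?_
        split_ifs
        · have : δ * -s₀.2 n ≠ 0 := by
            change δ * -v' n ≠ 0
            rw [hv1, neg_neg]; positivity
          fun_prop (disch := assumption)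
        · fun_prop
      refine hc.eventually (p := fun s => Crossing n _ n δ (-1) s 0) ?_
      convert ha using 2
      funext i
      change (if i < n then v' i / (δ * -v' n) else v i / (δ * a)) = _
      rw [hv1, neg_neg]
      split_ifs with hi
      · rw [hv2 i hi]
      · rfl
    obtain ⟨U, hUc, hU, hs₀⟩ := eventually_nhds_iff.1 (e1.and (e2.and (e3.and e4)))
    obtain ⟨y, w, hyw, hw⟩ := exists_past_of_sorts (φ := (n + 1).choose 2) hpos hU ⟨_, hs₀⟩
      (fun s hs => (hUc s hs).1) fun s hs => by
        obtain ⟨-, h2, h3, h4⟩ := hUc s hs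
        have hc : 0 < δ * -s.2 n := mul_pos hδ (neg_pos.2 h3)
        refine ((h4.sorts hδ le_rfl fun i hi => ?_).smul hc).congr (fun _ _ => rfl)
          fun i hi => ?_
        · rw [if_pos (by omega), if_pos hi]
          exact div_lt_div_of_pos_right (h2 i hi) hc
        · simp only [Pi.smul_apply, smul_eq_mul, joinAt]
          rcases Nat.lt_succ_iff_lt_or_eq.1 hi with hi | rfl
          · rw [if_pos hi, if_pos hi, mul_div_cancel₀ _ hc.ne']
          · rw [if_neg (lt_irrefl _), if_pos rfl]
            field_simp
    have hchoose : (n + 2).choose 3 = (r + 2).choose 3 + (n + 1).choose 2 :=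
      (Nat.choose_succ_succ' (r + 2) 2).trans (Nat.add_comm _ _)
    exact ⟨-a - 1, y, w, hchoose ▸ hyw, hw⟩

/-! ### Boxes of masses around one and the conclusion. -/

theorem ExistsOpenWithCollisions.mono {n N : ℕ} {B B' : Set (Fin n → ℝ)}
    (h : ExistsOpenWithCollisions B N) (hB : B ⊆ B') : ExistsOpenWithCollisions B' N := by
  obtain ⟨W, U, h1, h2, h3, h4⟩ := h
  exact ⟨W, U, h1, h2, h3.trans (inter_subset_inter_left _ hB), h4⟩

theorem existsOpenWithCollisions_box {n N : ℕ} {ε b : ℝ} {m x v : ℕ → ℝ}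
    (hm : ∀ k, 0 < m k) (hmε : ∀ k < n, |m k - 1| < ε) (h : Past n b N m x v)
    (hv : Ascending n v) :
    ExistsOpenWithCollisions {m : Fin n → ℝ | ∀ k, m k ∈ Ioo (1 - ε) (1 + ε)} N := by
  refine h.existsOpenWithCollisions hm hv (eventually_all.2 fun k => ?_)
  have := abs_lt.1 (hmε k k.2)
  exact (continuous_apply k).continuousAt.eventually (Ioo_mem_nhds (by linarith) (by linarith))

theorem existsOpenWithCollisions_near_one {n : ℕ} (hn : 1 ≤ n) {ε : ℝ} (hε : 0 < ε) :
    ExistsOpenWithCollisions {m : Fin n → ℝ | ∀ k, m k ∈ Ioo (1 - ε) (1 + ε)} (n - 1) ∧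
    ExistsOpenWithCollisions {m : Fin n → ℝ | ∀ k, m k ∈ Ioo (1 - ε) (1 + ε)} (n.choose 2) ∧
    ExistsOpenWithCollisions {m : Fin n → ℝ | ∀ k, m k ∈ Ioo (1 - ε) (1 + ε)}
      ((n + 1).choose 3) := by
  obtain ⟨r, rfl⟩ : ∃ r, n = r + 1 := ⟨n - 1, by omega⟩
  refine ⟨?_, ?_, ?_⟩
  · obtain ⟨m, b, x, v, hm, hP, -, -, hv⟩ := exists_past_pred hε r
    exact existsOpenWithCollisions_box (fun k => (hm k).1) (fun k _ => (hm k).2) hP hv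
  · obtain ⟨x, v, hP, hv⟩ := exists_past_choose_two (r + 1)
    exact existsOpenWithCollisions_box (fun _ => one_pos) (fun k _ => by simpa using hε) hP hv
  · have e1 : ∀ᶠ δ in 𝓝[>] (0 : ℝ), ∀ k ∈ Finset.range (r + 1), |convexMass δ k - 1| < ε := by
      rw [Finset.eventually_all]
      intro k _
      have := continuous_pi_iff.1 continuous_convexMass k
      refine nhdsWithin_le_nhds (ContinuousAt.eventually_lt (by fun_prop) (by fun_prop) ?_)
      simpa [convexMass] using hε
    have e2 : ∀ᶠ δ in 𝓝[>] (0 : ℝ), ∀ q ∈ Finset.range (r + 1), ∀ᶠ s in 𝓝 (0 : ℕ → ℝ),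
        Crossing q ((q + 1).choose 2) q δ (-1) s 0 := by
      rw [Finset.eventually_all]
      exact fun q _ => eventually_crossing q
    obtain ⟨δ, hδ, h1, h2⟩ := (eventually_mem_nhdsWithin.and (e1.and e2)).exists
    have hδ : 0 < δ := hδ
    obtain ⟨b, x, v, hP, hv⟩ := exists_past_choose_three hδ (n := r)
      fun q hq => h2 q (Finset.mem_range.2 (by omega))
    exact existsOpenWithCollisions_box (convexMass_pos hδ.le)
      (fun k hk => h1 k (Finset.mem_range.2 hk)) hP hv

theorem theorem1 (n : ℕ) (hn : 1 ≤ n) :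
    (∀ ε : ℝ, 0 < ε →
      ExistsOpenWithCollisions {m : Fin n → ℝ | ∀ k, m k ∈ Set.Ioo (1 - ε) (1 + ε)} (n - 1) ∧
      ExistsOpenWithCollisions {m : Fin n → ℝ | ∀ k, m k ∈ Set.Ioo (1 - ε) (1 + ε)}
        (n.choose 2) ∧
      ExistsOpenWithCollisions {m : Fin n → ℝ | ∀ k, m k ∈ Set.Ioo (1 - ε) (1 + ε)}
        ((n + 1).choose 3)) ∧
    (∀ O ∈ 𝓝ˢ (massDiagonal n),
      ExistsOpenWithCollisions O (n - 1) ∧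
      ExistsOpenWithCollisions O (n.choose 2) ∧
      ExistsOpenWithCollisions O ((n + 1).choose 3)) := by
  refine ⟨fun ε hε => existsOpenWithCollisions_near_one hn hε, fun O hO => ?_⟩
  have hO1 : O ∈ 𝓝 (fun _ : Fin n => (1 : ℝ)) :=
    mem_nhdsSet_iff_forall.1 hO _ ⟨1, one_pos, fun _ => rfl⟩
  obtain ⟨ε, hε, hball⟩ := Metric.mem_nhds_iff.1 hO1
  have hsub : {m : Fin n → ℝ | ∀ k, m k ∈ Ioo (1 - ε) (1 + ε)} ⊆ O := fun m hm =>
    hball ((dist_pi_lt_iff hε).2 fun k => by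
      rw [Real.dist_eq, abs_lt]
      have h := hm k
      exact ⟨by linarith [h.1], by linarith [h.2]⟩)
  obtain ⟨h1, h2, h3⟩ := existsOpenWithCollisions_near_one hn hε
  exact ⟨h1.mono hsub, h2.mono hsub, h3.mono hsub⟩
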